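/- Let $\mathcal A$ be a homological category (pointed, regular and protomodular) in which every normal epimorphism is an effective descent morphism. Let $(\mathcal T,\mathcal F)$ be a torsion theory in $\mathcal A$ such that (P) the reflector $\mathcal A\to\mathcal F$ is protoadditive, i.e. preserves split short exact sequences, and (N) for every morphism $f\colon A\to B$ the composite $T(K[f])\to K[f]\to A$ of the coreflection counit of the kernel $K[f]$ into $\mathcal T$ with $\ker(f)$ is a normal monomorphism. Let $\mathcal N$ be the class of normal epimorphisms of $\mathcal A$. For a class $\mathcal E$ of morphisms in a category $\mathcal C$, let $\mathcal E^1$ be the class of those morphisms $(f,f')\colon a\to b$ of the arrow category $\mathsf{Arr}(\mathcal C)$ for which $a$, $b$, $f$, $f'$, the two projections of the pullback of $f'$ and $b$, and the comparison morphism from the domain of $a$ to this pullback all lie in $\mathcal E$. Put $\mathcal N^0=\mathcal N$ and $\mathcal N^{n}=(\mathcal N^{n-1})^1$, let $\mathsf{Ext}^0(\mathcal A)=\mathcal A$, and for $n\ge 1$ let $\mathsf{Ext}^n(\mathcal A)$ be the full subcategory of $\mathsf{Arr}^n(\mathcal A)$ whose objects, the $n$-fold $\mathcal N$-extensions, are the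 elements of $\mathcal N^{n-1}$. Let $\iota^n\colon\mathcal A\to\mathsf{Arr}^n(\mathcal A)$ be the $n$-th iterate of the functor $\iota$ sending $X$ to $X\to 0$, and let $\mathcal T_n$ be the replete image of $\mathcal T$ under $\iota^n$. Let $\mathcal F_0=\mathcal F$, and let $\mathcal F_n$ be the full subcategory of $\mathsf{Arr}^n(\mathcal A)$ of those morphisms of $\mathsf{Arr}^{n-1}(\mathcal A)$ whose kernel lies in $\mathcal F_{n-1}$. Finally put $\mathsf{NExt}^0_{\mathcal F}(\mathcal A)=\mathcal F$, and for $n\ge 1$ let $\mathsf{NExt}^n_{\mathcal F}(\mathcal A)$ consist of the $n$-fold $\mathcal N$-extensions that are normal extensions, in the sense of categorical Galois theory, with respect to the Galois structure $\Gamma_{n-1}$ on $\mathsf{Ext}^{n-1}(\mathcal A)$ given by its subcategory $\mathsf{NExt}^{n-1}_{\mathcal F}(\mathcal A)$ and the class of all morphisms if $n=1$, the class $\mathcal N^{n-1}$ if $n\ge 2$. (A morphism $f$ of the class is a normal extension if the change of base functor $f^*$ between the categories of morphisms of the class over the codomain and over the domain of $f$ is monadic, and the naturality square of the reflection units at the pullback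 of $f$ along itself is a pullback.) Then each $\Gamma_n$ ($n\ge 0$) is an admissible Galois structure, and for every $n\ge 1$: 1. $\mathcal T_n\subseteq\mathsf{Ext}^n(\mathcal A)$, and $(\mathcal T_n,\mathsf{NExt}^n_{\mathcal F}(\mathcal A))$ is a torsion theory in $\mathsf{Ext}^n(\mathcal A)$; 2. $\mathsf{NExt}^n_{\mathcal F}(\mathcal A)=\mathcal F_n\cap\mathsf{Ext}^n(\mathcal A)$; 3. an $n$-fold $\mathcal N$-extension $A$, viewed as an $n$-dimensional cube with initial ribs $a_1,\dots,a_n$ (the edges out of its initial vertex), lies in $\mathsf{NExt}^n_{\mathcal F}(\mathcal A)$ if and only if $\bigcap_{1\le i\le n}K[a_i]\in\mathcal F$. -/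

import Mathlib

open CategoryTheory CategoryTheory.Limits

universe w v u v' u'

namespace HigherTorsion

/-! ### Kernels, short exact sequences, homological categories -/

section Pointed

variable {C : Type u} [Category.{v} C] [HasZeroMorphisms C]

/-- `k` is a kernel of `f`. -/
def IsKernel {K X Y : C} (k : K ⟶ X) (f : X ⟶ Y) : Prop :=
  ∃ h : k ≫ f = 0, Nonempty (IsLimit (KernelFork.ofι k h))

/-- `f` is a cokernel of `k`. -/
def IsCokernel {K X Y : C} (k : K ⟶ X) (f : X ⟶ Y) : Prop :=
  ∃ h : k ≫ f = 0, Nonempty (IsColimit (CokernelCofork.ofπ f h))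

/-- `0 ⟶ K ⟶ X ⟶ Y ⟶ 0` is a short exact sequence: `k = ker f` and `f = coker k`. -/
def IsShortExact {K X Y : C} (k : K ⟶ X) (f : X ⟶ Y) : Prop :=
  IsKernel k f ∧ IsCokernel k f

/-- `(k, f, s)` is a split short exact sequence: `k = ker f` and `f ∘ s = 1`. -/
def IsSplitShortExact {K X Y : C} (k : K ⟶ X) (f : X ⟶ Y) (s : Y ⟶ X) : Prop :=
  IsKernel k f ∧ s ≫ f = 𝟙 Y

/-- The class of normal epimorphisms. -/
def normalEpis (C : Type u) [Category.{v} C] [HasZeroMorphisms C] : MorphismProperty C :=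
  fun _ _ f => Nonempty (NormalEpi f)

variable (C) in
/-- The split short five lemma. -/
def SplitShortFive : Prop :=
  ∀ ⦃K A B K' A' B' : C⦄ (k : K ⟶ A) (f : A ⟶ B) (s : B ⟶ A)
    (k' : K' ⟶ A') (f' : A' ⟶ B') (s' : B' ⟶ A')
    (κ : K ⟶ K') (α : A ⟶ A') (β : B ⟶ B'),
    IsSplitShortExact k f s → IsSplitShortExact k' f' s' →
    k ≫ α = κ ≫ k' → f ≫ β = α ≫ f' → s ≫ α = β ≫ s' →
    IsIso κ → IsIso β → IsIso α

variable (C) in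
/-- A homological category: pointed, regular (in particular finitely complete) and protomodular. -/
class Homological : Prop extends Regular C, HasZeroObject C where
  splitShortFive : SplitShortFive C

/-- A functor between pointed categories is protoadditive if it preserves split short exact
sequences. -/
def IsProtoadditive {D : Type u'} [Category.{v'} D] [HasZeroMorphisms D] (G : C ⥤ D) : Prop :=
  ∀ ⦃K A B : C⦄ (k : K ⟶ A) (f : A ⟶ B) (s : B ⟶ A),
    IsSplitShortExact k f s → IsSplitShortExact (G.map k) (G.map f) (G.map s)

/-! ### Torsion theories -/

/-- `(T, F)` is a torsion theory in the pointed category `C`. -/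
structure IsTorsionTheory (T F : ObjectProperty C) : Prop where
  pointed : HasZeroObject C
  replete_torsion : T.IsClosedUnderIsomorphisms
  replete_torsionFree : F.IsClosedUnderIsomorphisms
  hom_eq_zero : ∀ ⦃X Y : C⦄, T X → F Y → ∀ f : X ⟶ Y, f = 0
  exists_shortExact : ∀ A : C, ∃ (X Y : C) (t : X ⟶ A) (q : A ⟶ Y),
    T X ∧ F Y ∧ IsShortExact t q

/-- `t : X ⟶ Y` is a coreflection (counit) of `Y` into the full subcategory `T`. -/
structure IsCoreflection (T : ObjectProperty C) {X Y : C} (t : X ⟶ Y) : Prop where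
  mem : T X
  existsUnique : ∀ ⦃Z : C⦄, T Z → ∀ g : Z ⟶ Y, ∃! h : Z ⟶ X, h ≫ t = g

/-- Condition (P): the reflector to the full subcategory `F` is protoadditive. -/
def ConditionP (F : ObjectProperty C) : Prop :=
  ∃ R : C ⥤ F.FullSubcategory, Nonempty (R ⊣ F.ι) ∧ IsProtoadditive R

/-- Condition (N): for every morphism `f : A ⟶ B`, the composite `T(K[f]) ⟶ K[f] ⟶ A` of the
coreflection counit of `K[f]` with the kernel of `f` is a normal monomorphism. -/
def ConditionN (T : ObjectProperty C) : Prop :=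
  ∀ ⦃A B K S : C⦄ (f : A ⟶ B) (k : K ⟶ A) (t : S ⟶ K),
    IsKernel k f → IsCoreflection T t → Nonempty (NormalMono (t ≫ k))

end Pointed

/-! ### Categorical Galois theory -/

section Galois

variable {D : Type u} [Category.{v} D]

/-- `η : X ⟶ Y` is a reflection (unit) of `X` into the full subcategory `P`. -/
structure IsReflection (P : ObjectProperty D) {X Y : D} (η : X ⟶ Y) : Prop where
  mem : P Y
  existsUnique : ∀ ⦃Z : D⦄, P Z → ∀ g : X ⟶ Z, ∃! h : Y ⟶ Z, η ≫ h = g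

/-- `R` is the change of base functor `p^* : (D ↓_Q B) ⥤ (D ↓_Q E)`, sending `f : A ⟶ B` in `Q` to
its pullback along `p`. Here `Q.Over ⊤ B` is the full subcategory of `Over B` on the morphisms
lying in `Q`. -/
def IsChangeOfBase (Q : MorphismProperty D) {E B : D} (p : E ⟶ B)
    (R : Q.Over ⊤ B ⥤ Q.Over ⊤ E) : Prop :=
  ∃ π : ∀ X : Q.Over ⊤ B, (R.obj X).left ⟶ X.left,
    (∀ X, IsPullback (π X) (R.obj X).hom X.hom p) ∧
    ∀ ⦃X Y : Q.Over ⊤ B⦄ (g : X ⟶ Y), (R.map g).left ≫ π Y = π X ≫ g.left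

/-- `p ∈ Q` is a monadic extension (with respect to `Q`): the change of base functor `p^*` is
monadic. -/
def IsMonadicExtension (Q : MorphismProperty D) {E B : D} (p : E ⟶ B) : Prop :=
  Q p ∧ ∃ R : Q.Over ⊤ B ⥤ Q.Over ⊤ E,
    IsChangeOfBase Q p R ∧ Nonempty (MonadicRightAdjoint R)

/-- An effective descent morphism is a monadic extension with respect to the class of all
morphisms. -/
def IsEffectiveDescent {E B : D} (p : E ⟶ B) : Prop :=
  IsMonadicExtension (⊤ : MorphismProperty D) p

/-- The full replete reflective subcategory `P` and the class `Q` form a Galois structure. -/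
structure IsGaloisStructure (P : ObjectProperty D) (Q : MorphismProperty D) : Prop where
  replete : P.IsClosedUnderIsomorphisms
  reflective : ∀ X : D, ∃ (Y : D) (η : X ⟶ Y), IsReflection P η
  hasPullback : ∀ ⦃X Y Z : D⦄ (f : X ⟶ Z) (g : Y ⟶ Z), Q g → HasPullback f g
  isos : ∀ ⦃X Y : D⦄ (f : X ⟶ Y), IsIso f → Q f
  comp : Q.IsStableUnderComposition
  baseChange : Q.IsStableUnderBaseChange
  reflector_mem : ∀ ⦃X Y X' Y' : D⦄ (f : X ⟶ Y) (ηX : X ⟶ X') (ηY : Y ⟶ Y') (f' : X' ⟶ Y'),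
    IsReflection P ηX → IsReflection P ηY → ηX ≫ f' = f ≫ ηY → Q f → Q f'

/-- The Galois structure is admissible: for every `B`, with reflection `η : B ⟶ B'`, the functor
`U^B`, sending `φ : X ⟶ B'` in `Q`, with `X` in `P`, to its pullback along `η`, is fully faithful. -/
structure IsAdmissibleGaloisStructure (P : ObjectProperty D) (Q : MorphismProperty D) : Prop
    extends IsGaloisStructure P Q where
  fullyFaithful : ∀ ⦃B B' X Y U V : D⦄ (η : B ⟶ B') (φ : X ⟶ B') (ψ : Y ⟶ B')
    (u₁ : U ⟶ B) (u₂ : U ⟶ X) (v₁ : V ⟶ B) (v₂ : V ⟶ Y),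
    IsReflection P η → P X → P Y → Q φ → Q ψ →
    IsPullback u₁ u₂ η φ → IsPullback v₁ v₂ η ψ →
    ∀ a : U ⟶ V, a ≫ v₁ = u₁ → ∃! b : X ⟶ Y, b ≫ ψ = φ ∧ a ≫ v₂ = u₂ ≫ b

/-- `f ∈ Q` is a trivial extension: the naturality square of the reflection units at `f` is a
pullback. -/
def IsTrivialExtension (P : ObjectProperty D) (Q : MorphismProperty D) {X Y : D} (f : X ⟶ Y) :
    Prop :=
  Q f ∧ ∃ (X' Y' : D) (ηX : X ⟶ X') (ηY : Y ⟶ Y') (f' : X' ⟶ Y'),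
    IsReflection P ηX ∧ IsReflection P ηY ∧ IsPullback ηX f f' ηY

/-- `f` is a normal extension: a monadic extension such that `f^*(f)`, the first projection of the
kernel pair of `f`, is a trivial extension. -/
def IsNormalExtension (P : ObjectProperty D) (Q : MorphismProperty D) {X Y : D} (f : X ⟶ Y) :
    Prop :=
  IsMonadicExtension Q f ∧
    ∃ (R : D) (p₁ p₂ : R ⟶ X), IsPullback p₁ p₂ f f ∧ IsTrivialExtension P Q p₁

end Galois

/-! ### The category of arrows -/

section Arrow

variable {C : Type u} [Category.{v} C]

/-- The class `E¹` of morphisms `(f, f') : a ⟶ b` of the arrow category: all of `f`, `f'`, `a`, `b`,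
the projections of the pullback of `f'` and `b`, and the comparison morphism to that pullback lie
in `E`. -/
def doubleClass (E : MorphismProperty C) : MorphismProperty (Arrow C) :=
  fun a b f => E f.left ∧ E f.right ∧ E a.hom ∧ E b.hom ∧
    ∃ (P : C) (p₁ : P ⟶ a.right) (p₂ : P ⟶ b.left) (r : a.left ⟶ P),
      IsPullback p₁ p₂ f.right b.hom ∧ r ≫ p₁ = a.hom ∧ r ≫ p₂ = f.left ∧
        E p₁ ∧ E p₂ ∧ E r

variable [HasZeroMorphisms C]

instance arrowHasZeroMorphisms : HasZeroMorphisms (Arrow C) where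
  zero a b := ⟨Arrow.homMk (0 : a.left ⟶ b.left) (0 : a.right ⟶ b.right) (by simp)⟩
  comp_zero f Z := by
    apply Arrow.hom_ext
    · exact comp_zero
    · exact comp_zero
  zero_comp X _ _ f := by
    apply Arrow.hom_ext
    · exact zero_comp
    · exact zero_comp

instance arrowHasZeroObject [HasZeroObject C] : HasZeroObject (Arrow C) := by
  obtain ⟨Z, hZ⟩ := HasZeroObject.zero (C := C)
  refine ⟨⟨Arrow.mk (𝟙 Z), ?_⟩⟩
  rw [IsZero.iff_id_eq_zero]
  apply Arrow.hom_ext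
  · exact hZ.eq_of_src _ _
  · exact hZ.eq_of_src _ _

open scoped ZeroObject in
/-- The functor `ι` sending `X` to the morphism `X ⟶ 0`. -/
noncomputable def iotaFunctor (C : Type u) [Category.{v} C] [HasZeroMorphisms C]
    [HasZeroObject C] : C ⥤ Arrow C where
  obj X := Arrow.mk (0 : X ⟶ (0 : C))
  map f := Arrow.homMk f (𝟙 (0 : C)) (by simp)
  map_id X := by apply Arrow.hom_ext <;> simp
  map_comp f g := by apply Arrow.hom_ext <;> simp

end Arrow

/-! ### The tower of higher extensions -/

/-- The data attached to `n`-fold morphisms in `A`. This is only a record, used through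
`Level.base` (for `n = 0`) and `Level.next` (from `n` to `n + 1`), which build all of its fields. -/
structure Level (A : Type u) [Category.{v} A] where
  /-- the category `Arrⁿ(A)` of `n`-fold morphisms -/
  Obj : Type w
  [cat : Category.{v} Obj]
  [hasZeroMorphisms : HasZeroMorphisms Obj]
  [hasZeroObject : HasZeroObject Obj]
  /-- the `n`-fold extensions, as a full subcategory `Extⁿ(A)` of `Arrⁿ(A)` -/
  ext : ObjectProperty Obj
  /-- the class `Eⁿ` of morphisms in `Arrⁿ(A)`, the elements of which are the `(n + 1)`-fold
  extensions -/
  cls : MorphismProperty Obj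
  /-- the class of morphisms in `Arrⁿ(A)` which, restricted to `Extⁿ(A)`, is the one of the Galois
  structure -/
  galoisCls : MorphismProperty Obj
  /-- the functor `ιⁿ : A ⥤ Arrⁿ(A)` -/
  iota : A ⥤ Obj
  /-- the subcategory `Fₙ` of `Arrⁿ(A)` -/
  torsionFree : ObjectProperty Obj
  /-- the subcategory `NExtⁿ(A)` of `n`-fold normal extensions -/
  normalExt : ObjectProperty Obj
  /-- the initial vertex of an `n`-dimensional cube -/
  top : Obj ⥤ A
  /-- the `n` initial ribs `aᵢ` of an `n`-dimensional cube, as morphisms out of the initial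
  vertex -/
  ribs : ∀ X : Obj, List (Under (top.obj X))

namespace Level

attribute [instance] Level.cat Level.hasZeroMorphisms Level.hasZeroObject

section

variable {A : Type u} [Category.{v} A] (L : Level.{w} A)

/-- The full subcategory `NExtⁿ(A)` of `Extⁿ(A)`. -/
abbrev normalExtIn : ObjectProperty L.ext.FullSubcategory :=
  L.normalExt.inverseImage L.ext.ι

/-- The class of morphisms of the Galois structure on `Extⁿ(A)`. -/
abbrev galoisIn : MorphismProperty L.ext.FullSubcategory :=
  L.galoisCls.inverseImage L.ext.ι

/-- The `(n + 1)`-fold extension `a` (a morphism of `n`-fold extensions) is normal with respect to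
the Galois structure on `Extⁿ(A)` determined by `NExtⁿ(A)`. -/
def IsNormal (a : Arrow L.Obj) : Prop :=
  ∃ (hl : L.ext a.left) (hr : L.ext a.right),
    IsNormalExtension L.normalExtIn L.galoisIn
      (ObjectProperty.homMk a.hom :
        (⟨a.left, hl⟩ : L.ext.FullSubcategory) ⟶ ⟨a.right, hr⟩)

/-- From `n`-fold to `(n + 1)`-fold morphisms. -/
noncomputable def next : Level.{max w v} A where
  Obj := Arrow L.Obj
  ext := fun a => L.cls a.hom
  cls := doubleClass L.cls
  galoisCls := doubleClass L.cls
  iota := L.iota ⋙ iotaFunctor L.Obj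
  torsionFree := fun a => ∃ (K : L.Obj) (k : K ⟶ a.left), IsKernel k a.hom ∧ L.torsionFree K
  normalExt := fun a => L.cls a.hom ∧ L.IsNormal a
  top := Arrow.leftFunc ⋙ L.top
  ribs := fun a => (Under.mk (L.top.map a.hom) : Under (L.top.obj a.left)) :: L.ribs a.left

end

/-- The level `n = 0`: the category `A`, the class of normal epimorphisms, the torsion-free part `F`,
and the absolute Galois structure. -/
def base {A : Type u} [Category.{v} A] [HasZeroMorphisms A] [HasZeroObject A]
    (F : ObjectProperty A) : Level.{u} A where
  Obj := A
  ext := ⊤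
  cls := normalEpis A
  galoisCls := ⊤
  iota := 𝟭 A
  torsionFree := F
  normalExt := F
  top := 𝟭 A
  ribs := fun _ => []

/-- `tower F k` is the level `n = k + 1`. -/
noncomputable def tower {A : Type u} [Category.{v} A] [HasZeroMorphisms A] [HasZeroObject A]
    (F : ObjectProperty A) : ℕ → Level.{max u v} A
  | 0 => (base F).next
  | k + 1 => (tower F k).next

/-- The intersection `⋂ᵢ K[aᵢ]` of the kernels of the initial ribs of the cube `X`, as a subobject
of its initial vertex. -/
noncomputable def ribKernel {A : Type u} [Category.{v} A] [HasZeroMorphisms A]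
    [HasFiniteLimits A] (L : Level.{w} A) (X : L.Obj) : Subobject (L.top.obj X) :=
  (L.ribs X).foldr (fun a S => kernelSubobject a.hom ⊓ S) ⊤

/-- The Galois structure on `Extⁿ(A)` determined by `NExtⁿ(A)` is an admissible Galois structure. -/
def IsAdmissible {A : Type u} [Category.{v} A] (L : Level.{w} A) : Prop :=
  IsAdmissibleGaloisStructure L.normalExtIn L.galoisIn

end Level

end HigherTorsion

/-! A morphism from ιⁿS to an n-fold cube X is the same as a morphism from S to the initial vertex
that is killed by every initial rib. Hence ιⁿ has a right adjoint sending X to its rib kernel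
⋂K[aᵢ], and the torsion part of X has to be ιⁿ of the torsion part of that kernel. The rib kernel is
the kernel of a single morphism, so (N) makes its torsion part a normal subobject of the initial
vertex. Dividing it out there and leaving all other vertices alone gives a unit X → X' in 𝒩ⁿ. The
rib kernel of X' is the old one modulo its torsion part, hence torsion-free. So the extensions
receiving only zero morphisms from 𝒯ₙ form the torsion-free part of a torsion theory with units in
𝒩ⁿ (`Level.IsRegular.isExtTorsion`). Admissibility follows, since pulling such a unit back leaves
its torsion kernel unchanged.

It remains to see by induction on n that these extensions are the normal ones. For f in 𝒩ⁿ,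
normality amounts to this: a morphism from 𝒯ₙ killed by f is zero
(`IsExtTorsion.isNormalExtension_iff`). If f is normal and f kills u, then (0, u) into the kernel
pair is killed by the first projection and by the unit, so u = 0. Conversely, the first projection
is a split epimorphism with torsion-free kernel. By (P) it induces an isomorphism of torsion parts,
so the two units in its naturality square have isomorphic kernels and the square is a pullback.
Morphisms from ιⁿS killed by f are exactly the morphisms ιⁿ⁺¹S → f, so the criterion says that f is
torsion-free one level up. The same reading describes ℱₙ and the rib kernel condition.

Monadicity is carried up the tower through Beck's conditions in terms of pullback squares
(`IsBeckDescent`), which can be checked componentwise on arrows. They are extracted from effective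
descent in the base and turned back into relative monadicity at each level. The whole induction is
packaged in `Level.IsRegular`, with step `Level.IsRegular.next`. -/

namespace HigherTorsion

/-! ### Kernels, cokernels and pullbacks by element-style criteria -/

section Elementary

variable {C : Type u} [Category.{v} C]

theorem isPullback_of_existsUnique {P X Y Z : C} {fst : P ⟶ X} {snd : P ⟶ Y} {f : X ⟶ Z}
    {g : Y ⟶ Z} (w : fst ≫ f = snd ≫ g)
    (H : ∀ ⦃W : C⦄ (a : W ⟶ X) (b : W ⟶ Y), a ≫ f = b ≫ g →
      ∃ l : W ⟶ P, l ≫ fst = a ∧ l ≫ snd = b)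
    (U : ∀ ⦃W : C⦄ (l l' : W ⟶ P), l ≫ fst = l' ≫ fst → l ≫ snd = l' ≫ snd → l = l') :
    IsPullback fst snd f g :=
  ⟨⟨w⟩, ⟨PullbackCone.IsLimit.mk w (fun s => (H s.fst s.snd s.condition).choose)
    (fun s => (H s.fst s.snd s.condition).choose_spec.1)
    (fun s => (H s.fst s.snd s.condition).choose_spec.2)
    (fun s _ h₁ h₂ => U _ _
      (h₁.trans (H s.fst s.snd s.condition).choose_spec.1.symm)
      (h₂.trans (H s.fst s.snd s.condition).choose_spec.2.symm))⟩⟩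

variable [HasZeroMorphisms C]

theorem isKernel_iff {K X Y : C} {k : K ⟶ X} {f : X ⟶ Y} :
    IsKernel k f ↔
      k ≫ f = 0 ∧ Mono k ∧ ∀ ⦃Z : C⦄ (g : Z ⟶ X), g ≫ f = 0 → ∃ h : Z ⟶ K, h ≫ k = g := by
  constructor
  · rintro ⟨h, ⟨hl⟩⟩
    refine ⟨h, ⟨fun a b hab => Fork.IsLimit.hom_ext hl hab⟩, fun Z g hg => ?_⟩
    exact ⟨_, (KernelFork.IsLimit.lift' hl g hg).2⟩
  · rintro ⟨h, hm, H⟩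
    exact ⟨h, ⟨KernelFork.IsLimit.ofι' k h fun g hg => ⟨(H g hg).choose, (H g hg).choose_spec⟩⟩⟩

theorem isCokernel_iff {K X Y : C} {k : K ⟶ X} {f : X ⟶ Y} :
    IsCokernel k f ↔
      k ≫ f = 0 ∧ Epi f ∧ ∀ ⦃Z : C⦄ (g : X ⟶ Z), k ≫ g = 0 → ∃ h : Y ⟶ Z, f ≫ h = g := by
  constructor
  · rintro ⟨h, ⟨hl⟩⟩
    refine ⟨h, ⟨fun a b hab => Cofork.IsColimit.hom_ext hl hab⟩, fun Z g hg => ?_⟩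
    exact ⟨_, (CokernelCofork.IsColimit.desc' hl g hg).2⟩
  · rintro ⟨h, hm, H⟩
    exact ⟨h, ⟨CokernelCofork.IsColimit.ofπ' f h fun g hg => ⟨(H g hg).choose, (H g hg).choose_spec⟩⟩⟩

variable {K X Y Z : C} {k : K ⟶ X} {f : X ⟶ Y}

theorem IsKernel.zero (h : IsKernel k f) : k ≫ f = 0 := (isKernel_iff.1 h).1
theorem IsKernel.mono (h : IsKernel k f) : Mono k := (isKernel_iff.1 h).2.1
theorem IsKernel.lift (h : IsKernel k f) (g : Z ⟶ X) (hg : g ≫ f = 0) : ∃ l, l ≫ k = g :=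
  (isKernel_iff.1 h).2.2 g hg
theorem IsCokernel.zero (h : IsCokernel k f) : k ≫ f = 0 := (isCokernel_iff.1 h).1
theorem IsCokernel.epi (h : IsCokernel k f) : Epi f := (isCokernel_iff.1 h).2.1
theorem IsCokernel.desc (h : IsCokernel k f) (g : X ⟶ Z) (hg : k ≫ g = 0) : ∃ l, f ≫ l = g :=
  (isCokernel_iff.1 h).2.2 g hg

theorem exists_isKernel [HasKernels C] (f : X ⟶ Y) : ∃ (K : C) (k : K ⟶ X), IsKernel k f :=
  ⟨kernel f, kernel.ι f, kernel.condition f, ⟨kernelIsKernel f⟩⟩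

/-- A kernel restricts along a pullback square. -/
theorem IsKernel.of_isPullback {P Y' : C} {fst : P ⟶ X} {snd : P ⟶ Y'} {g : Y' ⟶ Y}
    (h : IsKernel k f) (sq : IsPullback fst snd f g) {j : K ⟶ P} (h₁ : j ≫ fst = k)
    (h₂ : j ≫ snd = 0) : IsKernel j snd := by
  have := h.mono
  refine isKernel_iff.2 ⟨h₂, mono_of_mono_fac h₁, fun Z a ha => ?_⟩
  obtain ⟨l, hl⟩ := h.lift (a ≫ fst) (by rw [Category.assoc, sq.w, reassoc_of% ha, zero_comp])
  exact ⟨l, sq.hom_ext (by rw [Category.assoc, h₁, hl]) (by rw [Category.assoc, h₂, ha, comp_zero])⟩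

theorem IsKernel.comp_iso {K' : C} (h : IsKernel k f) (e : K' ⟶ K) [IsIso e] :
    IsKernel (e ≫ k) f := by
  have := h.mono
  refine isKernel_iff.2 ⟨by rw [Category.assoc, h.zero, comp_zero], mono_comp _ _, fun Z g hg => ?_⟩
  obtain ⟨l, hl⟩ := h.lift g hg
  exact ⟨l ≫ inv e, by simp [hl]⟩

theorem normalEpi_iff [HasKernels C] : Nonempty (NormalEpi f) ↔
    ∀ ⦃K : C⦄ (k : K ⟶ X), IsKernel k f → IsCokernel k f := by
  constructor
  · rintro ⟨⟨W, g, w, hc⟩⟩ K k hk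
    have hc' : IsCokernel g f := ⟨w, ⟨hc⟩⟩
    obtain ⟨l, hl⟩ := hk.lift g w
    exact isCokernel_iff.2 ⟨hk.zero, hc'.epi, fun Z a ha => hc'.desc a (by
      rw [← hl, Category.assoc, ha, comp_zero])⟩
  · intro H
    obtain ⟨K, k, hk⟩ := exists_isKernel f
    obtain ⟨w, ⟨hc⟩⟩ := H k hk
    exact ⟨⟨K, k, w, hc⟩⟩

theorem IsCokernel.normalEpi (h : IsCokernel k f) : Nonempty (NormalEpi f) := by
  obtain ⟨w, ⟨hc⟩⟩ := h
  exact ⟨⟨K, k, w, hc⟩⟩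

end Elementary

/-! ### Limits and cokernels in the arrow category, componentwise -/

section ArrowLimits

variable {C : Type u} [Category.{v} C]

theorem arrow_isPullback {P X Y Z : Arrow C} {fst : P ⟶ X} {snd : P ⟶ Y} {f : X ⟶ Z} {g : Y ⟶ Z}
    (hl : IsPullback fst.left snd.left f.left g.left)
    (hr : IsPullback fst.right snd.right f.right g.right) : IsPullback fst snd f g := by
  refine isPullback_of_existsUnique (Arrow.hom_ext _ _ hl.w hr.w) (fun W a b hab => ?_)
    (fun W l l' h₁ h₂ => ?_)
  · have h₁ : a.left ≫ f.left = b.left ≫ g.left := congrArg (·.left) hab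
    have h₂ : a.right ≫ f.right = b.right ≫ g.right := congrArg (·.right) hab
    refine ⟨Arrow.homMk (hl.lift _ _ h₁) (hr.lift _ _ h₂) ?_, ?_, ?_⟩
    · apply hr.hom_ext
      · rw [Category.assoc, Category.assoc, ← Arrow.w fst, hr.lift_fst, hl.lift_fst_assoc, Arrow.w]
      · rw [Category.assoc, Category.assoc, ← Arrow.w snd, hr.lift_snd, hl.lift_snd_assoc, Arrow.w]
    · apply Arrow.hom_ext <;> simp
    · apply Arrow.hom_ext <;> simp
  · apply Arrow.hom_ext
    · exact hl.hom_ext (congrArg (·.left) h₁) (congrArg (·.left) h₂)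
    · exact hr.hom_ext (congrArg (·.right) h₁) (congrArg (·.right) h₂)

/-- Morphisms from `𝟙 W` to X correspond to morphisms from W to the domain of X, so these test
objects detect the limit. -/
theorem arrow_isPullback_left {P X Y Z : Arrow C} {fst : P ⟶ X} {snd : P ⟶ Y} {f : X ⟶ Z}
    {g : Y ⟶ Z} (h : IsPullback fst snd f g) :
    IsPullback fst.left snd.left f.left g.left := by
  refine isPullback_of_existsUnique (congrArg (·.left) h.w) (fun W a b hab => ?_)
    (fun W l l' h₁ h₂ => ?_)
  · let a' : Arrow.mk (𝟙 W) ⟶ X := Arrow.homMk a (a ≫ X.hom)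
    let b' : Arrow.mk (𝟙 W) ⟶ Y := Arrow.homMk b (b ≫ Y.hom)
    have hab' : a' ≫ f = b' ≫ g := by
      apply Arrow.hom_ext
      · exact hab
      · simp [a', b', ← Arrow.w, reassoc_of% hab]
    exact ⟨(h.lift a' b' hab').left, congrArg (·.left) (h.lift_fst a' b' hab'),
      congrArg (·.left) (h.lift_snd a' b' hab')⟩
  · let m : Arrow.mk (𝟙 W) ⟶ P := Arrow.homMk l (l ≫ P.hom)
    let m' : Arrow.mk (𝟙 W) ⟶ P := Arrow.homMk l' (l' ≫ P.hom)
    have : m = m' := by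
      apply h.hom_ext <;> apply Arrow.hom_ext
      · exact h₁
      · simp [m, m', ← Arrow.w, reassoc_of% h₁]
      · exact h₂
      · simp [m, m', ← Arrow.w, reassoc_of% h₂]
    exact congrArg (·.left) this

variable [HasZeroMorphisms C]

@[simp] theorem arrow_zero_left {X Y : Arrow C} : (0 : X ⟶ Y).left = 0 := rfl
@[simp] theorem arrow_zero_right {X Y : Arrow C} : (0 : X ⟶ Y).right = 0 := rfl

open scoped ZeroObject

/-- Here the test objects are the arrows 0 → W, whose morphisms to X are the morphisms from W to the
codomain of X. -/
theorem arrow_isPullback_right [HasZeroObject C] {P X Y Z : Arrow C} {fst : P ⟶ X} {snd : P ⟶ Y}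
    {f : X ⟶ Z} {g : Y ⟶ Z} (h : IsPullback fst snd f g) :
    IsPullback fst.right snd.right f.right g.right := by
  refine isPullback_of_existsUnique (congrArg (·.right) h.w) (fun W a b hab => ?_)
    (fun W l l' h₁ h₂ => ?_)
  · let a' : Arrow.mk (0 : 0 ⟶ W) ⟶ X := Arrow.homMk (0 : 0 ⟶ X.left) a
    let b' : Arrow.mk (0 : 0 ⟶ W) ⟶ Y := Arrow.homMk (0 : 0 ⟶ Y.left) b
    have hab' : a' ≫ f = b' ≫ g := by
      apply Arrow.hom_ext
      · simp [a', b']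
      · exact hab
    exact ⟨(h.lift a' b' hab').right, congrArg (·.right) (h.lift_fst a' b' hab'),
      congrArg (·.right) (h.lift_snd a' b' hab')⟩
  · let m : Arrow.mk (0 : 0 ⟶ W) ⟶ P := Arrow.homMk (0 : 0 ⟶ P.left) l
    let m' : Arrow.mk (0 : 0 ⟶ W) ⟶ P := Arrow.homMk (0 : 0 ⟶ P.left) l'
    have : m = m' := by
      apply h.hom_ext <;> apply Arrow.hom_ext
      · rfl
      · exact h₁
      · rfl
      · exact h₂
    exact congrArg (·.right) this

theorem arrow_isKernel {K X Y : Arrow C} {k : K ⟶ X} {f : X ⟶ Y} (hl : IsKernel k.left f.left)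
    (hr : IsKernel k.right f.right) : IsKernel k f := by
  have := hl.mono
  have := hr.mono
  refine isKernel_iff.2 ⟨Arrow.hom_ext _ _ hl.zero hr.zero, ⟨fun a b hab => ?_⟩, fun Z g hg => ?_⟩
  · apply Arrow.hom_ext
    · exact (cancel_mono k.left).1 (congrArg (·.left) hab)
    · exact (cancel_mono k.right).1 (congrArg (·.right) hab)
  · obtain ⟨l, h₁⟩ := hl.lift g.left (congrArg (·.left) hg)
    obtain ⟨r, h₂⟩ := hr.lift g.right (congrArg (·.right) hg)
    refine ⟨Arrow.homMk l r ?_, Arrow.hom_ext _ _ h₁ h₂⟩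
    rw [← cancel_mono k.right, Category.assoc, ← Arrow.w k, reassoc_of% h₁, Category.assoc, h₂,
      Arrow.w]

theorem arrow_isKernel_left {K X Y : Arrow C} {k : K ⟶ X} {f : X ⟶ Y} (h : IsKernel k f) :
    IsKernel k.left f.left := by
  have := h.mono
  refine isKernel_iff.2 ⟨congrArg (·.left) h.zero, inferInstance, fun Z g hg => ?_⟩
  let g' : Arrow.mk (𝟙 Z) ⟶ X := Arrow.homMk g (g ≫ X.hom)
  obtain ⟨l, hl⟩ := h.lift g' (by
    apply Arrow.hom_ext
    · exact hg
    · simp [g', ← Arrow.w, reassoc_of% hg])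
  exact ⟨l.left, congrArg (·.left) hl⟩

theorem arrow_isKernel_right [HasZeroObject C] {K X Y : Arrow C} {k : K ⟶ X} {f : X ⟶ Y}
    (h : IsKernel k f) : IsKernel k.right f.right := by
  have := h.mono
  have H : ∀ ⦃Z : C⦄ (g : Z ⟶ X.right), g ≫ f.right = 0 → ∃ h : Z ⟶ K.right, h ≫ k.right = g := by
    intro Z g hg
    let g' : Arrow.mk (0 : 0 ⟶ Z) ⟶ X := Arrow.homMk (0 : 0 ⟶ X.left) g
    obtain ⟨l, hl⟩ := h.lift g' (by
      apply Arrow.hom_ext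
      · simp [g']
      · exact hg)
    exact ⟨l.right, congrArg (·.right) hl⟩
  refine isKernel_iff.2 ⟨congrArg (·.right) h.zero, ⟨fun {Z} a b hab => ?_⟩, H⟩
  let a' : Arrow.mk (0 : 0 ⟶ Z) ⟶ K := Arrow.homMk (0 : 0 ⟶ K.left) a
  let b' : Arrow.mk (0 : 0 ⟶ Z) ⟶ K := Arrow.homMk (0 : 0 ⟶ K.left) b
  have : a' = b' := by
    rw [← cancel_mono k]
    apply Arrow.hom_ext
    · simp [a', b']
    · exact hab
  exact congrArg (·.right) this

theorem arrow_isCokernel {K X Y : Arrow C} {k : K ⟶ X} {f : X ⟶ Y} (hl : IsCokernel k.left f.left)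
    (hr : IsCokernel k.right f.right) : IsCokernel k f := by
  have := hl.epi
  have := hr.epi
  refine isCokernel_iff.2 ⟨Arrow.hom_ext _ _ hl.zero hr.zero, ⟨fun a b hab => ?_⟩,
    fun Z g hg => ?_⟩
  · apply Arrow.hom_ext
    · exact (cancel_epi f.left).1 (congrArg (·.left) hab)
    · exact (cancel_epi f.right).1 (congrArg (·.right) hab)
  · obtain ⟨l, h₁⟩ := hl.desc g.left (congrArg (·.left) hg)
    obtain ⟨r, h₂⟩ := hr.desc g.right (congrArg (·.right) hg)
    refine ⟨Arrow.homMk l r ?_, Arrow.hom_ext _ _ h₁ h₂⟩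
    rw [← cancel_epi f.left, reassoc_of% h₁, reassoc_of% Arrow.w f, h₂, Arrow.w]

theorem arrow_isZero_left {X : Arrow C} (h : IsZero X) : IsZero X.left := by
  rw [IsZero.iff_id_eq_zero] at h ⊢
  exact congrArg (·.left) h

theorem arrow_isZero_right {X : Arrow C} (h : IsZero X) : IsZero X.right := by
  rw [IsZero.iff_id_eq_zero] at h ⊢
  exact congrArg (·.right) h

end ArrowLimits

/-! ### Beck's conditions and their passage to arrows -/

section Descent

variable {C : Type u} [Category.{v} C]

/-- Beck's conditions for the change of base functor along `p`, in terms of pullback squares: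
pulling back along `p` reflects isomorphisms, and a parallel pair over `B` whose pullback along `p`
is part of a split coequalizer has a coequalizer, which is preserved by pulling back. -/
structure IsBeckDescent {E B : C} (p : E ⟶ B) : Prop where
  reflects : ∀ ⦃X Y X' Y' : C⦄ (x : X ⟶ B) (y : Y ⟶ B) (h : X ⟶ Y) (x' : X' ⟶ E) (y' : Y' ⟶ E)
    (πX : X' ⟶ X) (πY : Y' ⟶ Y) (h' : X' ⟶ Y'), h ≫ y = x → h' ≫ y' = x' →
    IsPullback πX x' x p → IsPullback πY y' y p → h' ≫ πY = πX ≫ h → IsIso h' → IsIso h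
  coeq : ∀ ⦃X Y X' Y' Z' : C⦄ (x : X ⟶ B) (y : Y ⟶ B) (f g : X ⟶ Y) (x' : X' ⟶ E) (y' : Y' ⟶ E)
    (πX : X' ⟶ X) (πY : Y' ⟶ Y) (f' g' : X' ⟶ Y') (z' : Z' ⟶ E) (q' : Y' ⟶ Z'),
    f ≫ y = x → g ≫ y = x → f' ≫ y' = x' → g' ≫ y' = x' → IsPullback πX x' x p →
    IsPullback πY y' y p → f' ≫ πY = πX ≫ f → g' ≫ πY = πX ≫ g → q' ≫ z' = y' →
    Nonempty (IsSplitCoequalizer f' g' q') →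
    ∃ (Z : C) (z : Z ⟶ B) (q : Y ⟶ Z) (r : Z' ⟶ Z), q ≫ z = y ∧ f ≫ q = g ≫ q ∧
      IsPullback r z' z p ∧ q' ≫ r = πY ≫ q ∧ Epi q ∧
      ∀ ⦃V : C⦄ (h : Y ⟶ V), f ≫ h = g ≫ h → ∃ m : Z ⟶ V, q ≫ m = h

theorem arrow_isBeckDescent [HasZeroMorphisms C] [HasZeroObject C] {E B : Arrow C} {p : E ⟶ B}
    (hl : IsBeckDescent p.left) (hr : IsBeckDescent p.right) : IsBeckDescent p where
  reflects X Y X' Y' x y h x' y' πX πY h' e₁ e₂ sX sY e₃ hh := by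
    have := hl.reflects x.left y.left h.left x'.left y'.left πX.left πY.left h'.left
      (congrArg (·.left) e₁) (congrArg (·.left) e₂) (arrow_isPullback_left sX)
      (arrow_isPullback_left sY) (congrArg (·.left) e₃) inferInstance
    have := hr.reflects x.right y.right h.right x'.right y'.right πX.right πY.right h'.right
      (congrArg (·.right) e₁) (congrArg (·.right) e₂) (arrow_isPullback_right sX)
      (arrow_isPullback_right sY) (congrArg (·.right) e₃) inferInstance
    exact Arrow.isIso_of_isIso_left_of_isIso_right h
  coeq X Y X' Y' Z' x y f g x' y' πX πY f' g' z' q' e₁ e₂ e₃ e₄ sX sY e₅ e₆ e₇ hs := by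
    obtain ⟨hs⟩ := hs
    obtain ⟨Zl, zl, ql, rl, a₁, a₂, a₃, a₄, a₅, a₆⟩ := hl.coeq x.left y.left f.left g.left
      x'.left y'.left πX.left πY.left f'.left g'.left z'.left q'.left
      (congrArg (·.left) e₁) (congrArg (·.left) e₂) (congrArg (·.left) e₃)
      (congrArg (·.left) e₄) (arrow_isPullback_left sX) (arrow_isPullback_left sY)
      (congrArg (·.left) e₅) (congrArg (·.left) e₆) (congrArg (·.left) e₇)
      ⟨hs.map Arrow.leftFunc⟩
    obtain ⟨Zr, zr, qr, rr, b₁, b₂, b₃, b₄, b₅, b₆⟩ := hr.coeq x.right y.right f.right g.right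
      x'.right y'.right πX.right πY.right f'.right g'.right z'.right q'.right
      (congrArg (·.right) e₁) (congrArg (·.right) e₂) (congrArg (·.right) e₃)
      (congrArg (·.right) e₄) (arrow_isPullback_right sX) (arrow_isPullback_right sY)
      (congrArg (·.right) e₅) (congrArg (·.right) e₆) (congrArg (·.right) e₇)
      ⟨hs.map Arrow.rightFunc⟩
    have : Epi q'.left := ⟨fun u v huv => by
      have hσ : hs.rightSection.left ≫ q'.left = 𝟙 _ := congrArg (·.left) hs.rightSection_π
      rw [← Category.id_comp u, ← Category.id_comp v, ← hσ, Category.assoc, huv, Category.assoc]⟩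
    -- The edge joining the two componentwise coequalizers. Its target `Zr` is not an object over
    -- the base of the left component, which is why the universal property in `IsBeckDescent` ranges
    -- over all objects of the category.
    obtain ⟨m, hm⟩ := a₆ (Y.hom ≫ qr) (by
      rw [reassoc_of% Arrow.w f, b₂, reassoc_of% Arrow.w g])
    refine ⟨Arrow.mk m, Arrow.homMk zl zr ?_, Arrow.homMk ql qr hm, Arrow.homMk rl rr ?_, ?_, ?_,
      arrow_isPullback a₃ b₃, ?_, ⟨fun u v huv => ?_⟩, fun V h hfg => ?_⟩
    · rw [← cancel_epi ql, reassoc_of% a₁, Arrow.w y, ← b₁]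
      exact (reassoc_of% hm) zr |>.symm
    · rw [← cancel_epi q'.left, reassoc_of% a₄]
      change πY.left ≫ ql ≫ m = _
      rw [hm, reassoc_of% Arrow.w πY, ← b₄, reassoc_of% Arrow.w q']
    · exact Arrow.hom_ext _ _ a₁ b₁
    · exact Arrow.hom_ext _ _ a₂ b₂
    · exact Arrow.hom_ext _ _ a₄ b₄
    · apply Arrow.hom_ext
      · exact (cancel_epi ql).1 (congrArg (·.left) huv)
      · exact (cancel_epi qr).1 (congrArg (·.right) huv)
    · obtain ⟨ml, hml⟩ := a₆ h.left (congrArg (·.left) hfg)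
      obtain ⟨mr, hmr⟩ := b₆ h.right (congrArg (·.right) hfg)
      refine ⟨Arrow.homMk ml mr ?_, Arrow.hom_ext _ _ hml hmr⟩
      rw [← cancel_epi ql, reassoc_of% hml]
      change _ = ql ≫ m ≫ mr
      rw [reassoc_of% hm, hmr, Arrow.w]

end Descent

/-! ### Normal epimorphisms in a homological category -/

section Homological

variable {A : Type u} [Category.{v} A] [HasZeroMorphisms A] [Homological A]

/-- Protomodularity: a subobject of the kernel pair containing the diagonal and the kernel of the
first projection is everything. If g kills ker f, the equalizer of the composites of g with the two
projections is such a subobject, so g coequalizes the kernel pair and factors through f. -/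
theorem normalEpi_of_isRegularEpi {X Y : A} (f : X ⟶ Y) [hf : IsRegularEpi f] :
    Nonempty (NormalEpi f) := by
  rw [normalEpi_iff]
  intro K k hk
  refine isCokernel_iff.2 ⟨hk.zero, inferInstance, fun Z g hg => ?_⟩
  have sq := IsPullback.of_hasPullback f f
  let d : X ⟶ pullback f f := pullback.lift (𝟙 X) (𝟙 X) rfl
  have hd₁ : d ≫ pullback.fst f f = 𝟙 X := pullback.lift_fst _ _ _
  have hd₂ : d ≫ pullback.snd f f = 𝟙 X := pullback.lift_snd _ _ _
  let j : K ⟶ pullback f f := pullback.lift 0 k (by rw [hk.zero, zero_comp])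
  have hj₁ : j ≫ pullback.fst f f = 0 := pullback.lift_fst _ _ _
  have hj₂ : j ≫ pullback.snd f f = k := pullback.lift_snd _ _ _
  have hj : IsKernel j (pullback.fst f f) :=
    hk.of_isPullback sq.flip (pullback.lift_snd _ _ _) (pullback.lift_fst _ _ _)
  let i := equalizer.ι (pullback.fst f f ≫ g) (pullback.snd f f ≫ g)
  obtain ⟨d₀, hd₀⟩ : ∃ d₀, d₀ ≫ i = d :=
    ⟨equalizer.lift d (by rw [reassoc_of% hd₁, reassoc_of% hd₂]), equalizer.lift_ι _ _⟩
  obtain ⟨j₀, hj₀⟩ : ∃ j₀, j₀ ≫ i = j :=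
    ⟨equalizer.lift j (by rw [reassoc_of% hj₁, reassoc_of% hj₂, hg, zero_comp]), equalizer.lift_ι _ _⟩
  have hmono : Mono i := inferInstance
  have hj₀k : IsKernel j₀ (i ≫ pullback.fst f f) := by
    have := hj.mono
    have : Mono (j₀ ≫ i) := by rwa [hj₀]
    refine isKernel_iff.2 ⟨by rw [reassoc_of% hj₀, hj.zero], mono_of_mono j₀ i, fun W a ha => ?_⟩
    obtain ⟨l, hl⟩ := hj.lift (a ≫ i) (by rwa [Category.assoc])
    exact ⟨l, by rw [← cancel_mono i, Category.assoc, hj₀, hl]⟩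
  have hi : IsIso i := Homological.splitShortFive j₀ (i ≫ pullback.fst f f) d₀ j
    (pullback.fst f f) d (𝟙 K) i (𝟙 X) ⟨hj₀k, by rw [reassoc_of% hd₀, hd₁]⟩
    ⟨hj, hd₁⟩ (by rw [hj₀, Category.id_comp]) (by rw [Category.comp_id])
    (by rw [hd₀, Category.id_comp]) inferInstance inferInstance
  have hpair : pullback.fst f f ≫ g = pullback.snd f f ≫ g := by
    rw [← cancel_epi i]
    exact equalizer.condition _ _
  obtain ⟨r⟩ := hf.regularEpi
  have hr : r.left ≫ g = r.right ≫ g := by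
    rw [← pullback.lift_fst_assoc r.left r.right r.w g, hpair, pullback.lift_snd_assoc]
  exact ⟨_, (Cofork.IsColimit.desc' r.isColimit g hr).2⟩

theorem normalEpi_iff_isRegularEpi {X Y : A} {f : X ⟶ Y} :
    Nonempty (NormalEpi f) ↔ IsRegularEpi f :=
  ⟨fun ⟨_⟩ => inferInstance, fun _ => normalEpi_of_isRegularEpi f⟩

theorem normalEpi_of_isIso {X Y : A} (f : X ⟶ Y) [IsIso f] : Nonempty (NormalEpi f) :=
  normalEpi_iff_isRegularEpi.2 inferInstance

theorem normalEpi_comp {X Y Z : A} {f : X ⟶ Y} {g : Y ⟶ Z} (hf : Nonempty (NormalEpi f))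
    (hg : Nonempty (NormalEpi g)) : Nonempty (NormalEpi (f ≫ g)) := by
  rw [normalEpi_iff_isRegularEpi] at *
  have := strongEpi_comp f g
  infer_instance

theorem normalEpi_of_comp {X Y Z : A} {f : X ⟶ Y} {g : Y ⟶ Z}
    (h : Nonempty (NormalEpi (f ≫ g))) : Nonempty (NormalEpi g) := by
  rw [normalEpi_iff_isRegularEpi] at *
  have := strongEpi_of_strongEpi f g
  infer_instance

theorem normalEpi_of_isPullback {P X Y Z : A} {fst : P ⟶ X} {snd : P ⟶ Y} {f : X ⟶ Z} {g : Y ⟶ Z}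
    (sq : IsPullback fst snd f g) (h : Nonempty (NormalEpi g)) : Nonempty (NormalEpi fst) := by
  rw [normalEpi_iff_isRegularEpi] at *
  exact Regular.regularEpiIsStableUnderBaseChange.of_isPullback sq.flip h

/-- A commutative square of normal epimorphisms which induces an isomorphism between the kernels
is a pullback. -/
theorem isPullback_of_isKernel {R R' X X' K : A} {q : R ⟶ R'} {q' : X ⟶ X'} {p : R ⟶ X}
    {p' : R' ⟶ X'} {k : K ⟶ R} (hq : IsBeckDescent q) (w : q ≫ p' = p ≫ q') (hk : IsKernel k q)
    (hkp : IsKernel (k ≫ p) q') : IsPullback q p p' q' := by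
  let c : R ⟶ pullback p' q' := pullback.lift q p w
  have hW := IsPullback.of_hasPullback p' q'
  have hc₁ : c ≫ pullback.fst p' q' = q := pullback.lift_fst _ _ _
  have hc₂ : c ≫ pullback.snd p' q' = p := pullback.lift_snd _ _ _
  have hkc : IsKernel (k ≫ c) (pullback.fst p' q') :=
    hkp.of_isPullback hW.flip (by rw [Category.assoc, hc₂]) (by rw [Category.assoc, hc₁, hk.zero])
  let w₁ := pullback.fst p' q'
  -- `h'` is the pullback of the comparison `c` along `q`. It is a morphism of split epimorphisms
  -- over R inducing an identity on kernels, hence invertible, and pulling back along `q` reflects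
  -- isomorphisms.
  let h' : pullback q q ⟶ pullback w₁ q :=
    pullback.lift (pullback.fst q q ≫ c) (pullback.snd q q)
      (by rw [Category.assoc, hc₁, pullback.condition])
  have h₁ : h' ≫ pullback.fst w₁ q = pullback.fst q q ≫ c := pullback.lift_fst _ _ _
  have h₂ : h' ≫ pullback.snd w₁ q = pullback.snd q q := pullback.lift_snd _ _ _
  let d : R ⟶ pullback q q := pullback.lift (𝟙 R) (𝟙 R) rfl
  have hd : d ≫ pullback.snd q q = 𝟙 R := pullback.lift_snd _ _ _
  let j : K ⟶ pullback q q := pullback.lift k 0 (by rw [hk.zero, zero_comp])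
  have hj₁ : j ≫ pullback.fst q q = k := pullback.lift_fst _ _ _
  have hj₂ : j ≫ pullback.snd q q = 0 := pullback.lift_snd _ _ _
  have hj : IsKernel j (pullback.snd q q) :=
    hk.of_isPullback (IsPullback.of_hasPullback q q) hj₁ hj₂
  have hj' : IsKernel (j ≫ h') (pullback.snd w₁ q) :=
    hkc.of_isPullback (IsPullback.of_hasPullback w₁ q)
      (by rw [Category.assoc, h₁, reassoc_of% hj₁]) (by rw [Category.assoc, h₂, hj₂])
  have hiso : IsIso h' := Homological.splitShortFive j (pullback.snd q q) d (j ≫ h')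
    (pullback.snd w₁ q) (d ≫ h') (𝟙 K) h' (𝟙 R) ⟨hj, hd⟩
    ⟨hj', by rw [Category.assoc, h₂, hd]⟩ (by rw [Category.id_comp])
    (by rw [Category.comp_id, h₂]) (by rw [Category.id_comp]) inferInstance inferInstance
  have hciso : IsIso c := hq.reflects q w₁ c (pullback.snd q q) (pullback.snd w₁ q)
    (pullback.fst q q) (pullback.fst w₁ q) h' hc₁ h₂ (IsPullback.of_hasPullback q q)
    (IsPullback.of_hasPullback w₁ q) h₁ hiso
  exact IsPullback.of_iso_pullback ⟨w⟩ (asIso c) hc₁ hc₂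

/-- A split epimorphism with trivial kernel is an isomorphism. -/
theorem isIso_of_split_of_kernel {X Y : A} (f : X ⟶ Y) (s : Y ⟶ X) (hs : s ≫ f = 𝟙 Y)
    (h : ∀ ⦃Z : A⦄ (z : Z ⟶ X), z ≫ f = 0 → z = 0) : IsIso f := by
  obtain ⟨K, k, hk⟩ := exists_isKernel f
  obtain ⟨L, l, hl⟩ := exists_isKernel (𝟙 Y)
  have hKz : k = 0 := h k hk.zero
  have hLz : l = 0 := by simpa using hl.zero
  have := hk.mono
  have := hl.mono
  have hK : IsZero K := by
    rw [IsZero.iff_id_eq_zero, ← cancel_mono k, hKz, comp_zero, comp_zero]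
  have hL : IsZero L := by
    rw [IsZero.iff_id_eq_zero, ← cancel_mono l, hLz, comp_zero, comp_zero]
  -- Comparison with the split extension given by the identity of Y; both kernels are zero objects.
  exact Homological.splitShortFive k f s l (𝟙 Y) (𝟙 Y) 0 f (𝟙 Y) ⟨hk, hs⟩ ⟨hl, by simp⟩
    (by rw [hk.zero, zero_comp]) (by simp) (by rw [hs, Category.comp_id])
    (hK.isoZero ≪≫ hL.isoZero.symm |>.isIso_hom |> fun h => by
      convert h using 1; exact hK.eq_of_src _ _) inferInstance

end Homological

/-! ### From effective descent to Beck's conditions -/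

section OverLemmas

variable {C : Type u} [Category.{v} C]

theorem isIso_of_isIso_map_of_monadic {D : Type u'} [Category.{v} D] (R : C ⥤ D)
    [MonadicRightAdjoint R] {X Y : C} (f : X ⟶ Y) [IsIso (R.map f)] : IsIso f := by
  have : R.ReflectsIsomorphisms :=
    reflectsIsomorphisms_of_iso (Monad.comparisonForget (monadicAdjunction R))
  exact isIso_of_reflects_iso f R

theorem over_isIso {Q : MorphismProperty C} {B : C} {X Y : Q.Over ⊤ B} (f : X ⟶ Y)
    [IsIso f.left] : IsIso f := by
  have : f = (MorphismProperty.Over.isoMk (asIso f.left)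
      (MorphismProperty.Over.w f) : X ≅ Y).hom := by
    ext
    rfl
  rw [this]
  infer_instance

theorem over_isIso_left {Q : MorphismProperty C} {B : C} {X Y : Q.Over ⊤ B} (f : X ⟶ Y)
    [IsIso f] : IsIso f.left :=
  inferInstanceAs (IsIso ((MorphismProperty.Over.forget Q ⊤ B ⋙ Over.forget B).map f))

/-- A monadic functor reflects isomorphisms and creates coequalizers of the pairs it splits. The
work lies in passing from the chosen functor to arbitrary pullback squares, and from coequalizers
over B to the ambient category. -/
theorem isBeckDescent_of_isEffectiveDescent [HasBinaryProducts C] {E B : C} {p : E ⟶ B}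
    (h : IsEffectiveDescent p) : IsBeckDescent p := by
  obtain ⟨-, R, ⟨π, hπ, hnat⟩, ⟨hR⟩⟩ := h
  obtain ⟨ρ, hρ, hπ⟩ : ∃ ρ : ∀ X, (R.obj X).left ⟶ E, (∀ X, ρ X = (R.obj X).hom) ∧
      ∀ X, IsPullback (π X) (ρ X) X.hom p := ⟨fun X => (R.obj X).hom, fun _ => rfl, hπ⟩
  have hρw : ∀ {X Y : (⊤ : MorphismProperty C).Over ⊤ B} (f : X ⟶ Y),
      (R.map f).left ≫ ρ Y = ρ X := fun {X Y} f => by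
    rw [hρ, hρ]
    exact MorphismProperty.Over.w _
  have key : ∀ {X Y : (⊤ : MorphismProperty C).Over ⊤ B} {X' Y' : C} (f : X ⟶ Y) (x' : X' ⟶ E)
      (y' : Y' ⟶ E) (f' : X' ⟶ Y') (eX : X' ≅ (R.obj X).left) (eY : Y' ≅ (R.obj Y).left)
      (_ : f' ≫ y' = x') (_ : eX.hom ≫ ρ X = x') (_ : eY.hom ≫ ρ Y = y')
      (_ : f' ≫ eY.hom ≫ π Y = eX.hom ≫ π X ≫ f.left),
      (R.map f).left = eX.inv ≫ f' ≫ eY.hom := by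
    intro X Y X' Y' f x' y' f' eX eY e₁ e₂ e₃ e₄
    apply (hπ Y).hom_ext
    · rw [hnat, Category.assoc, Category.assoc, e₄, eX.inv_hom_id_assoc]
    · rw [hρw, Category.assoc, Category.assoc, e₃, e₁, ← e₂, eX.inv_hom_id_assoc]
  have transport : ∀ {X : (⊤ : MorphismProperty C).Over ⊤ B} {X' : C} {x' : X' ⟶ E}
      {πX : X' ⟶ X.left}, IsPullback πX x' X.hom p →
      ∃ e : X' ≅ (R.obj X).left, e.hom ≫ π X = πX ∧ e.hom ≫ ρ X = x' := fun {X _ _ _} sX =>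
    ⟨sX.isoIsPullback _ _ (hπ X), IsPullback.isoIsPullback_hom_fst _ _ _ _,
      IsPullback.isoIsPullback_hom_snd _ _ _ _⟩
  constructor
  · intro X Y X' Y' x y h x' y' πX πY h' e₁ e₂ sX sY e₃ hh
    let X₀ : (⊤ : MorphismProperty C).Over ⊤ B := MorphismProperty.Over.mk ⊤ x trivial
    let Y₀ : (⊤ : MorphismProperty C).Over ⊤ B := MorphismProperty.Over.mk ⊤ y trivial
    let f : X₀ ⟶ Y₀ := MorphismProperty.Over.homMk h e₁
    obtain ⟨eX, hX₁, hX₂⟩ := transport (X := X₀) sX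
    obtain ⟨eY, hY₁, hY₂⟩ := transport (X := Y₀) sY
    have : IsIso (R.map f).left := by
      rw [key f x' y' h' eX eY e₂ hX₂ hY₂ (by rw [hY₁, reassoc_of% hX₁]; exact e₃)]
      infer_instance
    have := over_isIso (R.map f)
    have := isIso_of_isIso_map_of_monadic R f
    exact over_isIso_left f
  suffices H : ∀ {X₀ Y₀ : (⊤ : MorphismProperty C).Over ⊤ B} {X' Y' : C}
      {Z₀' : (⊤ : MorphismProperty C).Over ⊤ E} {y : Y₀.left ⟶ B} (f₀ g₀ : X₀ ⟶ Y₀) (x' : X' ⟶ E)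
      (y' : Y' ⟶ E) (z' : Z₀'.left ⟶ E) (πX : X' ⟶ X₀.left) (πY : Y' ⟶ Y₀.left) (f' g' : X' ⟶ Y')
      (q' : Y' ⟶ Z₀'.left), y = Y₀.hom → z' = Z₀'.hom → f' ≫ y' = x' → g' ≫ y' = x' →
      IsPullback πX x' X₀.hom p → IsPullback πY y' Y₀.hom p → f' ≫ πY = πX ≫ f₀.left →
      g' ≫ πY = πX ≫ g₀.left → q' ≫ z' = y' → Nonempty (IsSplitCoequalizer f' g' q') →
      ∃ (Z : C) (z : Z ⟶ B) (q : Y₀.left ⟶ Z) (r : Z₀'.left ⟶ Z), q ≫ z = y ∧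
        f₀.left ≫ q = g₀.left ≫ q ∧ IsPullback r z' z p ∧ q' ≫ r = πY ≫ q ∧ Epi q ∧
        ∀ ⦃V : C⦄ (h : Y₀.left ⟶ V), f₀.left ≫ h = g₀.left ≫ h → ∃ m : Z ⟶ V, q ≫ m = h by
    intro X Y X' Y' Z' x y f g x' y' πX πY f' g' z' q' e₁ e₂ e₃ e₄ sX sY e₅ e₆ e₇ hs
    exact H (X₀ := MorphismProperty.Over.mk ⊤ x trivial)
      (Y₀ := MorphismProperty.Over.mk ⊤ y trivial) (Z₀' := MorphismProperty.Over.mk ⊤ z' trivial)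
      (MorphismProperty.Over.homMk f e₁) (MorphismProperty.Over.homMk g e₂) x' y' z' πX πY f' g' q'
      rfl rfl e₃ e₄ sX sY e₅ e₆ e₇ hs
  · intro X₀ Y₀ X' Y' Z₀' y f₀ g₀ x' y' z' πX πY f' g' q' hy hz e₃ e₄ sX sY e₅ e₆ e₇ ⟨hs⟩
    obtain ⟨eX, hX₁, hX₂⟩ := transport sX
    obtain ⟨eY, hY₁, hY₂⟩ := transport sY
    have hf := key f₀ x' y' f' eX eY e₃ hX₂ hY₂ (by rw [hY₁, reassoc_of% hX₁]; exact e₅)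
    have hg := key g₀ x' y' g' eX eY e₄ hX₂ hY₂ (by rw [hY₁, reassoc_of% hX₁]; exact e₆)
    have hYinv : eY.inv ≫ y' = ρ Y₀ := by rw [← hY₂, eY.inv_hom_id_assoc]
    let q₀ : R.obj Y₀ ⟶ Z₀' := MorphismProperty.Over.homMk (eY.inv ≫ q') (by
      rw [← hz, ← hρ, Category.assoc, e₇, hYinv])
    have hsy : hs.rightSection ≫ y' = z' := by
      rw [← e₇, hs.rightSection_π_assoc]
    have htx : hs.leftSection ≫ x' = y' := by
      rw [← e₄, hs.leftSection_bottom_assoc]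
    let s₀ : Z₀' ⟶ R.obj Y₀ := MorphismProperty.Over.homMk (hs.rightSection ≫ eY.hom) (by
      rw [← hz, ← hρ, Category.assoc, hY₂, hsy])
    let t₀ : R.obj Y₀ ⟶ R.obj X₀ :=
      MorphismProperty.Over.homMk (eY.inv ≫ hs.leftSection ≫ eX.hom) (by
        rw [← hρ, ← hρ, Category.assoc, Category.assoc, hX₂, htx, hYinv])
    have split : IsSplitCoequalizer (R.map f₀) (R.map g₀) q₀ :=
      { rightSection := s₀
        leftSection := t₀
        condition := by
          ext
          change (R.map f₀).left ≫ eY.inv ≫ q' = (R.map g₀).left ≫ eY.inv ≫ q'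
          rw [hf, hg]
          simp only [Category.assoc, Iso.hom_inv_id_assoc, hs.condition]
        rightSection_π := by
          ext
          change (hs.rightSection ≫ eY.hom) ≫ eY.inv ≫ q' = 𝟙 _
          simp
        leftSection_bottom := by
          ext
          change (eY.inv ≫ hs.leftSection ≫ eX.hom) ≫ (R.map g₀).left = 𝟙 _
          rw [hg]
          simp
        leftSection_top := by
          ext
          change (eY.inv ≫ hs.leftSection ≫ eX.hom) ≫ (R.map f₀).left =
            (eY.inv ≫ q') ≫ hs.rightSection ≫ eY.hom
          rw [hf]
          simp }
    have hsplit : R.IsSplitPair f₀ g₀ := ⟨⟨_, _, ⟨split⟩⟩⟩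
    have := Monad.createsGSplitCoequalizersOfMonadic R f₀ g₀
    have : HasColimit (parallelPair f₀ g₀ ⋙ R) := by
      rw [hasColimit_iff_of_iso (diagramIsoParallelPair.{v} _)]
      exact inferInstanceAs (HasCoequalizer (R.map f₀) (R.map g₀))
    have : HasCoequalizer f₀ g₀ := hasColimit_of_created _ R
    have hc := isColimitOfHasCoequalizerOfPreservesColimit R f₀ g₀
    let Z₀ := coequalizer f₀ g₀
    let π₀ : Y₀ ⟶ Z₀ := coequalizer.π f₀ g₀
    let e : R.obj Z₀ ≅ Z₀' := hc.coconePointUniqueUpToIso split.isCoequalizer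
    have he : R.map π₀ ≫ e.hom = q₀ :=
      hc.comp_coconePointUniqueUpToIso_hom split.isCoequalizer WalkingParallelPair.one
    have he' : q₀ ≫ e.inv = R.map π₀ := by rw [← he, Category.assoc, e.hom_inv_id, Category.comp_id]
    have he'' : q' ≫ e.inv.left = eY.hom ≫ (R.map π₀).left := by
      have : (eY.inv ≫ q') ≫ e.inv.left = (R.map π₀).left :=
        congrArg (fun m : R.obj Y₀ ⟶ R.obj Z₀ => m.left) he'
      rw [← this]
      simp
    have hcomm : f₀ ≫ π₀ = g₀ ≫ π₀ := coequalizer.condition f₀ g₀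
    -- Morphisms over B into V × B → B are plain morphisms into V. This turns the universal property
    -- over B into one against every V.
    have hprod : ∀ V : C, ∃ (W : (⊤ : MorphismProperty C).Over ⊤ B) (φ : W.left ⟶ V),
        (∀ X (h : X.left ⟶ V), ∃ h₀ : X ⟶ W, h₀.left ≫ φ = h) ∧
        ∀ X (a b : X ⟶ W), a.left ≫ φ = b.left ≫ φ → a = b := fun V => by
      refine ⟨MorphismProperty.Over.mk ⊤ (prod.snd : V ⨯ B ⟶ B) trivial, prod.fst,
        fun X h => ⟨MorphismProperty.Over.homMk (prod.lift h X.hom) (prod.lift_snd _ _),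
          prod.lift_fst _ _⟩, fun X a b hab => ?_⟩
      ext
      exact Limits.prod.hom_ext hab
        ((MorphismProperty.Over.w a).trans (MorphismProperty.Over.w b).symm)
    have desc : ∀ ⦃V : C⦄ (h : Y₀.left ⟶ V), f₀.left ≫ h = g₀.left ≫ h →
        ∃ m : Z₀.left ⟶ V, π₀.left ≫ m = h := by
      intro V h hh
      obtain ⟨W, φ, hφ, hφ'⟩ := hprod V
      obtain ⟨h₀, hh₀⟩ := hφ _ h
      have hfg : f₀ ≫ h₀ = g₀ ≫ h₀ := by
        apply hφ'
        change (f₀.left ≫ h₀.left) ≫ φ = (g₀.left ≫ h₀.left) ≫ φ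
        rw [Category.assoc, Category.assoc, hh₀, hh]
      have : π₀.left ≫ (coequalizer.desc h₀ hfg).left = h₀.left :=
        congrArg (fun m => m.left) (coequalizer.π_desc h₀ hfg)
      exact ⟨(coequalizer.desc h₀ hfg).left ≫ φ, by rw [reassoc_of% this, hh₀]⟩
    have hZ₀ : e.inv.left ≫ ρ Z₀ = z' := by
      rw [hρ, hz]
      exact MorphismProperty.Over.w e.inv
    refine ⟨Z₀.left, Z₀.hom, π₀.left, e.inv.left ≫ π Z₀,
      (MorphismProperty.Over.w π₀).trans hy.symm,
      congrArg (fun m : X₀ ⟶ Z₀ => m.left) hcomm, ?_, ?_, ⟨fun {V} a b hab => ?_⟩, desc⟩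
    · have : IsIso e.inv.left := over_isIso_left e.inv
      refine (hπ Z₀).of_iso (asIso e.inv.left).symm (Iso.refl _) (Iso.refl _) (Iso.refl _)
        ?_ ?_ (by simp) (by simp)
      · simp
      · simp [← hZ₀]
    · rw [reassoc_of% he'', hnat, reassoc_of% hY₁]
    · obtain ⟨W, φ, hφ, hφ'⟩ := hprod V
      obtain ⟨a₀, ha₀⟩ := hφ _ a
      obtain ⟨b₀, hb₀⟩ := hφ _ b
      have hab₀ : a₀ = b₀ := by
        apply coequalizer.hom_ext
        apply hφ'
        change (π₀.left ≫ a₀.left) ≫ φ = (π₀.left ≫ b₀.left) ≫ φ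
        rw [Category.assoc, Category.assoc, ha₀, hb₀, hab]
      rw [← ha₀, ← hb₀, hab₀]

end OverLemmas

/-! ### From Beck's conditions to monadicity in a full subcategory -/

section FullSubcategory

variable {C : Type u} [Category.{v} C] {ext : ObjectProperty C}

theorem fullSubcategory_isPullback {P X Y Z : ext.FullSubcategory} {fst : P ⟶ X} {snd : P ⟶ Y}
    {f : X ⟶ Z} {g : Y ⟶ Z} (h : IsPullback fst.hom snd.hom f.hom g.hom) :
    IsPullback fst snd f g :=
  IsPullback.of_map_of_faithful ext.ι h

/-- A full subcategory need not inherit pullbacks; once an ambient pullback has its vertex in `ext`,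
any pullback inside is isomorphic to it. -/
theorem isPullback_hom_of_exists {P X Y Z : ext.FullSubcategory} {fst : P ⟶ X} {snd : P ⟶ Y}
    {f : X ⟶ Z} {g : Y ⟶ Z} (h : IsPullback fst snd f g) {P' : C} {fst' : P' ⟶ X.obj}
    {snd' : P' ⟶ Y.obj} (h' : IsPullback fst' snd' f.hom g.hom) (hP' : ext P') :
    IsPullback fst.hom snd.hom f.hom g.hom := by
  let Q : ext.FullSubcategory := ⟨P', hP'⟩
  have h'' : IsPullback (P := Q) (ObjectProperty.homMk fst') (ObjectProperty.homMk snd') f g :=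
    fullSubcategory_isPullback h'
  let e := h''.isoIsPullback _ _ h
  have e₁ : e.hom.hom ≫ fst.hom = fst' :=
    congrArg (fun m : Q ⟶ X => m.hom) (h''.isoIsPullback_hom_fst _ _ h)
  have e₂ : e.hom.hom ≫ snd.hom = snd' :=
    congrArg (fun m : Q ⟶ Y => m.hom) (h''.isoIsPullback_hom_snd _ _ h)
  exact h'.of_iso (ext.ι.mapIso e) (Iso.refl _) (Iso.refl _) (Iso.refl _) (by simp [e₁])
    (by simp [e₂]) (by simp) (by simp)

/-- Beck's monadicity theorem for the slices relative to `Q`. `pullbackMem` makes change of base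
land in them, and `descendMem` keeps the ambient coequalizer inside them. -/
theorem isMonadicExtension_of_isBeckDescent [HasPullbacks C] {Q : MorphismProperty C}
    {E B : ext.FullSubcategory} (p : E ⟶ B) (hp : Q p.hom)
    (comp : (Q.inverseImage ext.ι).IsStableUnderComposition)
    (pullbackMem : ∀ ⦃P X : C⦄ (fst : P ⟶ X) (snd : P ⟶ E.obj) (f : X ⟶ B.obj), ext X → Q f →
      IsPullback fst snd f p.hom → ext P ∧ Q snd)
    (descendMem : ∀ ⦃P X : C⦄ (fst : P ⟶ X) (snd : P ⟶ E.obj) (f : X ⟶ B.obj), ext P → Q snd →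
      IsPullback fst snd f p.hom → ext X ∧ Q f)
    (hd : IsBeckDescent p.hom) : IsMonadicExtension (Q.inverseImage ext.ι) p := by
  have key : ∀ ⦃P X : ext.FullSubcategory⦄ (fst : P ⟶ X) (snd : P ⟶ E) (f : X ⟶ B), Q f.hom →
      IsPullback fst snd f p → IsPullback fst.hom snd.hom f.hom p.hom := by
    intro P X fst snd f hf sq
    have sq' := IsPullback.of_hasPullback f.hom p.hom
    exact isPullback_hom_of_exists sq sq' (pullbackMem _ _ _ X.property hf sq').1
  let P := Q.inverseImage ext.ι
  have : P.HasPullbacksAlong p := ⟨fun {W} g hg => by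
    have sq := IsPullback.of_hasPullback g.hom p.hom
    let V : ext.FullSubcategory := ⟨_, (pullbackMem _ _ _ W.property hg sq).1⟩
    have : IsPullback (P := V) (ObjectProperty.homMk (pullback.fst g.hom p.hom))
      (ObjectProperty.homMk (pullback.snd g.hom p.hom)) g p := fullSubcategory_isPullback sq
    exact this.hasPullback⟩
  have : P.IsStableUnderBaseChangeAlong p := ⟨fun {X W _ _ _} sq hg =>
    (pullbackMem _ _ _ X.property hg (key _ _ _ hg sq)).2⟩
  have : P.IsStableUnderComposition := comp
  let R := MorphismProperty.Over.pullback P ⊤ p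
  refine ⟨hp, R, ⟨fun X => pullback.fst X.hom p, fun X => IsPullback.of_hasPullback _ _,
    fun X Y g => ?_⟩, ?_⟩
  · exact pullback.lift_fst _ _ _
  have hπ : ∀ X : P.Over ⊤ B, IsPullback (pullback.fst X.hom p).hom (pullback.snd X.hom p).hom
      X.hom.hom p.hom := fun X => key _ _ _ X.prop (IsPullback.of_hasPullback _ _)
  have hR₁ : ∀ {X Y : P.Over ⊤ B} (f : X ⟶ Y), (R.map f).left.hom ≫ (pullback.fst Y.hom p).hom =
      (pullback.fst X.hom p).hom ≫ f.left.hom := fun {X Y} f => by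
    have h : (R.map f).left ≫ pullback.fst Y.hom p = pullback.fst X.hom p ≫ f.left :=
      pullback.lift_fst _ _ _
    exact congrArg (fun m => m.hom) h
  have hR₂ : ∀ {X Y : P.Over ⊤ B} (f : X ⟶ Y), (R.map f).left.hom ≫ (pullback.snd Y.hom p).hom =
      (pullback.snd X.hom p).hom := fun {X Y} f => by
    have h : (R.map f).left ≫ pullback.snd Y.hom p = pullback.snd X.hom p :=
      pullback.lift_snd _ _ _
    exact congrArg (fun m => m.hom) h
  have hw : ∀ {B : ext.FullSubcategory} {X Y : P.Over ⊤ B} (f : X ⟶ Y),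
      f.left.hom ≫ Y.hom.hom = X.hom.hom := fun {B X _} f =>
    congrArg (fun m : X.left ⟶ B => m.hom) (MorphismProperty.Over.w f)
  have reflects : R.ReflectsIsomorphisms := ⟨fun {X Y} f _ => by
    have h := over_isIso_left (R.map f)
    have := hd.reflects X.hom.hom Y.hom.hom f.left.hom (pullback.snd X.hom p).hom
      (pullback.snd Y.hom p).hom (pullback.fst X.hom p).hom (pullback.fst Y.hom p).hom
      (R.map f).left.hom (hw f) (hR₂ f) (hπ X) (hπ Y) (hR₁ f)
      ((ObjectProperty.isIso_hom_iff _).2 h)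
    have : IsIso f.left := (ObjectProperty.isIso_hom_iff _).1 this
    exact over_isIso f⟩
  have coeq : ∀ {X Y : P.Over ⊤ B} (f g : X ⟶ Y) [R.IsSplitPair f g],
      ∃ (Z : P.Over ⊤ B) (q : Y ⟶ Z) (w : f ≫ q = g ≫ q),
        Nonempty (IsColimit (Cofork.ofπ q w)) ∧
          Nonempty (IsSplitCoequalizer (R.map f) (R.map g) (R.map q)) := by
    intro X Y f g ⟨Z', q', ⟨hs⟩⟩
    obtain ⟨Z, z, q, r, a₁, a₂, a₃, a₄, a₅, a₆⟩ := hd.coeq X.hom.hom Y.hom.hom f.left.hom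
      g.left.hom (pullback.snd X.hom p).hom
      (pullback.snd Y.hom p).hom (pullback.fst X.hom p).hom (pullback.fst Y.hom p).hom
      (R.map f).left.hom (R.map g).left.hom Z'.hom.hom q'.left.hom (hw f) (hw g) (hR₂ f) (hR₂ g)
      (hπ X) (hπ Y) (hR₁ f) (hR₁ g) (hw q')
      ⟨hs.map (MorphismProperty.Over.forget P ⊤ E ⋙ Over.forget E ⋙ ext.ι)⟩
    -- The pullback of the coequalizer along `p` is the split quotient `Z'`, which lies in the
    -- class; membership descends to `Z`.
    have hZ := descendMem r Z'.hom.hom z Z'.left.property Z'.prop a₃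
    let Z₁ : ext.FullSubcategory := ⟨Z, hZ.1⟩
    let z₁ : Z₁ ⟶ B := ObjectProperty.homMk z
    let Z₀ : P.Over ⊤ B := MorphismProperty.Over.mk ⊤ z₁ hZ.2
    let q₁ : Y.left ⟶ Z₁ := ObjectProperty.homMk q
    let q₀ : Y ⟶ Z₀ := MorphismProperty.Over.homMk q₁ (ObjectProperty.hom_ext _ a₁)
    let r₁ : Z'.left ⟶ Z₁ := ObjectProperty.homMk r
    have sq₁ : IsPullback r₁ Z'.hom z₁ p := fullSubcategory_isPullback a₃
    have : HasPullback z₁ p := MorphismProperty.HasPullbacksAlong.hasPullback (P := P) z₁ hZ.2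
    let e : R.obj Z₀ ≅ Z' := MorphismProperty.Over.isoMk
      ((IsPullback.of_hasPullback z₁ p).isoIsPullback _ _ sq₁)
      (IsPullback.isoIsPullback_hom_snd _ _ _ _)
    have he : R.map q₀ ≫ e.hom = q' := by
      ext : 1
      apply sq₁.hom_ext
      · have h₁ : e.hom.left ≫ r₁ = pullback.fst z₁ p := IsPullback.isoIsPullback_hom_fst _ _ _ _
        change ((R.map q₀).left ≫ e.hom.left) ≫ r₁ = q'.left ≫ r₁
        rw [Category.assoc, h₁]
        ext
        exact (hR₁ q₀).trans a₄.symm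
      · rw [MorphismProperty.Over.w, MorphismProperty.Over.w]
    have he' : R.map q₀ = q' ≫ e.inv := by rw [← he, Category.assoc, e.hom_inv_id, Category.comp_id]
    have w : f ≫ q₀ = g ≫ q₀ := by
      ext
      exact a₂
    have hq₀ : ∀ {V : P.Over ⊤ B} (a b : Z₀ ⟶ V), q₀ ≫ a = q₀ ≫ b → a = b := by
      intro V a b hab
      ext
      exact a₅.left_cancellation _ _ (congrArg (fun m : Y ⟶ V => m.left.hom) hab)
    refine ⟨Z₀, q₀, w, ⟨Cofork.IsColimit.mk' _ fun s => ?_⟩, ⟨?_⟩⟩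
    · have hm := a₆ s.π.left.hom (congrArg (fun m : X ⟶ s.pt => m.left.hom) s.condition)
      let m₀ : Z₀ ⟶ s.pt := MorphismProperty.Over.homMk (ObjectProperty.homMk hm.choose) (by
        ext
        refine a₅.left_cancellation _ _ ?_
        change q ≫ hm.choose ≫ s.pt.hom.hom = q ≫ z
        rw [reassoc_of% hm.choose_spec, a₁]
        exact hw s.π)
      have hm₀ : q₀ ≫ m₀ = s.π := by
        ext
        exact hm.choose_spec
      exact ⟨m₀, hm₀, fun {m} h => hq₀ _ _ (h.trans hm₀.symm)⟩
    · exact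
      { rightSection := e.hom ≫ hs.rightSection
        leftSection := hs.leftSection
        condition := by rw [← R.map_comp, w, R.map_comp]
        rightSection_π := by simp [he']
        leftSection_bottom := hs.leftSection_bottom
        leftSection_top := by
          rw [he', Category.assoc, e.inv_hom_id_assoc]
          exact hs.leftSection_top }
  have : Monad.HasCoequalizerOfIsSplitPair R := ⟨fun f g _ => by
    obtain ⟨Z, q, w, ⟨hc⟩, -⟩ := coeq f g
    exact ⟨⟨_, hc⟩⟩⟩
  have : Monad.PreservesColimitOfIsSplitPair R := ⟨fun f g _ => by
    obtain ⟨Z, q, w, ⟨hc⟩, ⟨hs⟩⟩ := coeq f g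
    exact preservesColimit_of_preserves_colimit_cocone hc
      ((isColimitMapCoconeCoforkEquiv R w).symm hs.isCoequalizer)⟩
  exact ⟨Monad.monadicOfHasPreservesGSplitCoequalizersOfReflectsIsomorphisms
    (MorphismProperty.Over.mapPullbackAdj P ⊤ p hp trivial)⟩

end FullSubcategory

/-! ### Axioms for extensions and their passage to double extensions -/

section ExtensionClass

variable {C : Type u} [Category.{v} C]

/-- Stability properties of a class `Q` of morphisms between the objects of `ext`, relative to a
class `E` of extensions. -/
structure IsRelativeClass (ext : ObjectProperty C) (E Q : MorphismProperty C) : Prop where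
  le : E ≤ Q
  iso : ∀ ⦃X Y : C⦄ (f : X ⟶ Y), ext X → ext Y → IsIso f → Q f
  comp : ∀ ⦃X Y Z : C⦄ (f : X ⟶ Y) (g : Y ⟶ Z), ext X → ext Y → ext Z → Q f → Q g → Q (f ≫ g)
  pullback : ∀ ⦃P X Y Z : C⦄ (fst : P ⟶ X) (snd : P ⟶ Y) (f : X ⟶ Z) (g : Y ⟶ Z),
    IsPullback fst snd f g → ext X → ext Y → ext Z → Q g → ext P ∧ Q fst
  cancel : ∀ ⦃X Y Z : C⦄ (f : X ⟶ Y) (g : Y ⟶ Z), ext X → ext Y → ext Z → E f → Q (f ≫ g) → Q g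
  descend : ∀ ⦃P X Y Z : C⦄ (fst : P ⟶ X) (snd : P ⟶ Y) (f : X ⟶ Z) (p : Y ⟶ Z),
    IsPullback fst snd f p → ext Y → ext Z → ext P → E p → Q snd → ext X ∧ Q f

/-- The properties of the class of (higher) extensions used to develop its Galois theory. -/
structure IsExtensionClass [HasZeroMorphisms C] (ext : ObjectProperty C)
    (E : MorphismProperty C) : Prop where
  rel : IsRelativeClass ext E E
  dom : ∀ ⦃X Y : C⦄ (f : X ⟶ Y), E f → ext X
  cod : ∀ ⦃X Y : C⦄ (f : X ⟶ Y), E f → ext Y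
  ext_of_iso : ∀ ⦃X Y : C⦄ (f : X ⟶ Y), IsIso f → ext X → ext Y
  ext_zero : ∀ ⦃Z : C⦄, IsZero Z → ext Z
  to_zero : ∀ ⦃X Z : C⦄ (f : X ⟶ Z), ext X → IsZero Z → E f
  isCokernel : ∀ ⦃K X Y : C⦄ (k : K ⟶ X) (q : X ⟶ Y), E q → IsKernel k q → IsCokernel k q
  isPullback_of_isKernel : ∀ ⦃R R' X X' K : C⦄ (q : R ⟶ R') (q' : X ⟶ X') (p : R ⟶ X)
    (p' : R' ⟶ X') (k : K ⟶ R), E q → q ≫ p' = p ≫ q' → IsKernel k q → IsKernel (k ≫ p) q' →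
    IsPullback q p p' q'
  isBeckDescent : ∀ ⦃X Y : C⦄ (p : X ⟶ Y), E p → IsBeckDescent p

namespace IsExtensionClass

variable [HasZeroMorphisms C] {ext : ObjectProperty C} {E : MorphismProperty C}
  (h : IsExtensionClass ext E)

include h

theorem mem_of_isIso {X Y : C} (f : X ⟶ Y) [IsIso f] (hX : ext X) : E f :=
  h.rel.iso f hX (h.ext_of_iso f inferInstance hX) inferInstance

theorem comp_mem {X Y Z : C} {f : X ⟶ Y} {g : Y ⟶ Z} (hf : E f) (hg : E g) : E (f ≫ g) :=
  h.rel.comp f g (h.dom f hf) (h.cod f hf) (h.cod g hg) hf hg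

theorem of_comp {X Y Z : C} {f : X ⟶ Y} {g : Y ⟶ Z} (hf : E f) (hfg : E (f ≫ g)) : E g :=
  h.rel.cancel f g (h.dom f hf) (h.cod f hf) (h.cod _ hfg) hf hfg

theorem fst_mem {P X Y Z : C} {fst : P ⟶ X} {snd : P ⟶ Y} {f : X ⟶ Z} {g : Y ⟶ Z}
    (sq : IsPullback fst snd f g) (hX : ext X) (hg : E g) : E fst :=
  (h.rel.pullback fst snd f g sq hX (h.dom g hg) (h.cod g hg) hg).2

theorem doubleClass_of {a b : Arrow C} {f : a ⟶ b} (hl : E f.left) (hr : E f.right)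
    (ha : E a.hom) (hb : E b.hom) {P : C} {p₁ : P ⟶ a.right} {p₂ : P ⟶ b.left} {r : a.left ⟶ P}
    (sq : IsPullback p₁ p₂ f.right b.hom) (h₁ : r ≫ p₁ = a.hom) (h₂ : r ≫ p₂ = f.left)
    (hr' : E r) : doubleClass E f :=
  ⟨hl, hr, ha, hb, P, p₁, p₂, r, sq, h₁, h₂, h.fst_mem sq (h.dom _ hr) hb,
    h.fst_mem sq.flip (h.dom _ hb) hr, hr'⟩

/-- `doubleClass` provides one pullback only; uniqueness up to isomorphism extends the comparison
condition to every choice. -/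
theorem comparison_mem {a b : Arrow C} {f : a ⟶ b} (hf : doubleClass E f) {P : C}
    {p₁ : P ⟶ a.right} {p₂ : P ⟶ b.left} {r : a.left ⟶ P}
    (sq : IsPullback p₁ p₂ f.right b.hom) (h₁ : r ≫ p₁ = a.hom) (h₂ : r ≫ p₂ = f.left) : E r := by
  obtain ⟨-, -, -, -, P', p₁', p₂', r', sq', h₁', h₂', -, -, hr'⟩ := hf
  let e := sq'.isoIsPullback _ _ sq
  have he : r = r' ≫ e.hom := by
    apply sq.hom_ext
    · rw [h₁, Category.assoc, IsPullback.isoIsPullback_hom_fst, h₁']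
    · rw [h₂, Category.assoc, IsPullback.isoIsPullback_hom_snd, h₂']
  rw [he]
  exact h.comp_mem hr' (h.mem_of_isIso e.hom (h.cod _ hr'))

theorem doubleClass_of_isIso {a b : Arrow C} (f : a ⟶ b) [IsIso f] (ha : E a.hom) (hb : E b.hom) :
    doubleClass E f :=
  h.doubleClass_of (h.mem_of_isIso _ (h.dom _ ha)) (h.mem_of_isIso _ (h.cod _ ha)) ha hb
    (P := a.left) (p₁ := a.hom) (p₂ := f.left) (r := 𝟙 _)
    (IsPullback.of_vert_isIso ⟨(Arrow.w f).symm⟩) (Category.id_comp _) (Category.id_comp _)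
    (h.mem_of_isIso _ (h.dom _ ha))

variable [HasPullbacks C]

/-- The comparison of the composite is the comparison of f followed by a pullback of the comparison
of g. -/
theorem doubleClass_comp {a b c : Arrow C} {f : a ⟶ b} {g : b ⟶ c} (hf : doubleClass E f)
    (hg : doubleClass E g) : doubleClass E (f ≫ g) := by
  have hf' := hf
  obtain ⟨hfl, hfr, ha, hb, P₁, p₁, p₂, rf, s₁, hp₁, hp₂, -, -, hrf⟩ := hf
  obtain ⟨hgl, hgr, -, hc, P₂, q₁, q₂, rg, s₂, hq₁, hq₂, hq₁E, hq₂E, hrg⟩ := hg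
  have T := IsPullback.of_hasPullback f.right q₁
  let m : P₁ ⟶ pullback f.right q₁ :=
    pullback.lift p₁ (p₂ ≫ rg) (by rw [s₁.w, Category.assoc, hq₁])
  have hm₁ : m ≫ pullback.fst f.right q₁ = p₁ := pullback.lift_fst _ _ _
  have hm₂ : m ≫ pullback.snd f.right q₁ = p₂ ≫ rg := pullback.lift_snd _ _ _
  have hM : IsPullback m p₂ (pullback.snd f.right q₁) rg :=
    IsPullback.of_right (by rw [hm₁, hq₁]; exact s₁) hm₂ T
  have hT : ext (pullback f.right q₁) := h.dom _ (h.fst_mem T (h.dom _ hfr) hq₁E)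
  refine h.doubleClass_of (h.comp_mem hfl hgl) (h.comp_mem hfr hgr) ha hc (T.paste_vert s₂)
    (r := rf ≫ m) ?_ ?_ (h.comp_mem hrf (h.fst_mem hM hT hrg))
  · rw [Category.assoc, hm₁, hp₁]
  · rw [Category.assoc, reassoc_of% hm₂, hq₂, reassoc_of% hp₂]
    rfl

/-- The comparison of the pulled back square is itself a pullback of the comparison of g, and
`P.hom` is this comparison followed by a projection in E. -/
theorem doubleClass_pullback {P X Y Z : Arrow C} {fst : P ⟶ X} {snd : P ⟶ Y} {f : X ⟶ Z}
    {g : Y ⟶ Z} (sl : IsPullback fst.left snd.left f.left g.left)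
    (sr : IsPullback fst.right snd.right f.right g.right) (hX : E X.hom) (hg : doubleClass E g) :
    E P.hom ∧ doubleClass E fst := by
  obtain ⟨hgl, hgr, hY, hZ, V, v₁, v₂, rg, s, hv₁, hv₂, hv₁E, hv₂E, hrg⟩ := hg
  have hfl := h.fst_mem sl (h.dom _ hX) hgl
  have hfr := h.fst_mem sr (h.cod _ hX) hgr
  have W := IsPullback.of_hasPullback fst.right X.hom
  let w₁ := pullback.fst fst.right X.hom
  let w₂ := pullback.snd fst.right X.hom
  have hw₁ : E w₁ := h.fst_mem W (h.dom _ hfr) hX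
  let r : P.left ⟶ pullback fst.right X.hom := pullback.lift P.hom fst.left (Arrow.w fst).symm
  have hr₁ : r ≫ w₁ = P.hom := pullback.lift_fst _ _ _
  have hr₂ : r ≫ w₂ = fst.left := pullback.lift_snd _ _ _
  let φ : pullback fst.right X.hom ⟶ V := s.lift (w₁ ≫ snd.right) (w₂ ≫ f.left) (by
    rw [Category.assoc, Category.assoc, Arrow.w f, ← sr.w]
    exact W.w_assoc _)
  have hφ₁ : φ ≫ v₁ = w₁ ≫ snd.right := s.lift_fst _ _ _
  have hφ₂ : φ ≫ v₂ = w₂ ≫ f.left := s.lift_snd _ _ _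
  have hW : IsPullback w₂ φ f.left v₂ := by
    refine IsPullback.of_bot (v₂₁ := v₁) (v₂₂ := Z.hom) (h₃₁ := g.right) ?_ hφ₂.symm s.flip
    rw [hφ₁, Arrow.w f]
    exact W.flip.paste_vert sr
  have hr : IsPullback r snd.left φ rg := by
    refine IsPullback.of_right (h₁₂ := w₂) (v₁₃ := f.left) (h₂₂ := v₂) ?_ ?_ hW
    · rw [hr₂, hv₂]
      exact sl
    · apply s.hom_ext
      · rw [Category.assoc, hφ₁, reassoc_of% hr₁, Category.assoc, hv₁, Arrow.w snd]
      · rw [Category.assoc, hφ₂, reassoc_of% hr₂, Category.assoc, hv₂, sl.w]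
  have hrE : E r := h.fst_mem hr (h.dom _ hw₁) hrg
  have hP : E P.hom := hr₁ ▸ h.comp_mem hrE hw₁
  exact ⟨hP, h.doubleClass_of hfl hfr hP hX W hr₁ hr₂ hrE⟩

/-- The comparison of f ≫ g followed by a projection in E equals `f.left` followed by the comparison
of g, so the latter is obtained by cancelling `f.left`. -/
theorem doubleClass_of_comp {a b c : Arrow C} {f : a ⟶ b} {g : b ⟶ c} (hf : doubleClass E f)
    (hfg : doubleClass E (f ≫ g)) : doubleClass E g := by
  have hgl : E g.left := h.of_comp hf.1 hfg.1
  have hgr : E g.right := h.of_comp hf.2.1 hfg.2.1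
  have hb : E b.hom := hf.2.2.2.1
  have hc : E c.hom := hfg.2.2.2.1
  have s₂ := IsPullback.of_hasPullback g.right c.hom
  let q₁ := pullback.fst g.right c.hom
  let q₂ := pullback.snd g.right c.hom
  have hq₁ : E q₁ := h.fst_mem s₂ (h.cod _ hb) hc
  let rg : b.left ⟶ pullback g.right c.hom := pullback.lift b.hom g.left (Arrow.w g).symm
  have hrg₁ : rg ≫ q₁ = b.hom := pullback.lift_fst _ _ _
  have hrg₂ : rg ≫ q₂ = g.left := pullback.lift_snd _ _ _
  have T := IsPullback.of_hasPullback f.right q₁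
  have hT₂ : E (pullback.snd f.right q₁) := h.fst_mem T.flip (h.dom _ hq₁) hf.2.1
  have w : a.hom ≫ f.right = (f.left ≫ rg) ≫ q₁ := by rw [Category.assoc, hrg₁, Arrow.w f]
  let r : a.left ⟶ pullback f.right q₁ := pullback.lift a.hom (f.left ≫ rg) w
  have hr₁ : r ≫ pullback.fst f.right q₁ = a.hom := pullback.lift_fst _ _ _
  have hr₂ : r ≫ pullback.snd f.right q₁ = f.left ≫ rg := pullback.lift_snd _ _ _
  have hr : E r := h.comparison_mem hfg (T.paste_vert s₂) hr₁ (by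
    rw [reassoc_of% hr₂]
    exact congrArg (f.left ≫ ·) hrg₂)
  exact h.doubleClass_of hgl hgr hb hc s₂ hrg₁ hrg₂
    (h.of_comp hf.1 (hr₂ ▸ h.comp_mem hr hT₂))

/-- The comparison of `snd` followed by a pullback `ψ` of `p.left` equals `fst.left` followed by the
comparison of f; then `fst.left` is cancelled. -/
theorem doubleClass_descend {P X Y Z : Arrow C} {fst : P ⟶ X} {snd : P ⟶ Y} {f : X ⟶ Z}
    {p : Y ⟶ Z} (sl : IsPullback fst.left snd.left f.left p.left)
    (sr : IsPullback fst.right snd.right f.right p.right) (hp : doubleClass E p)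
    (hsnd : doubleClass E snd) : E X.hom ∧ doubleClass E f := by
  obtain ⟨hsl, hsr, hP, hY, V, v₁, v₂, rs, s, hv₁, hv₂, hv₁E, hv₂E, hrs⟩ := hsnd
  have hZ : E Z.hom := hp.2.2.2.1
  obtain ⟨hXl, hfl⟩ := h.rel.descend _ _ _ _ sl (h.dom _ hY) (h.dom _ hZ) (h.dom _ hP) hp.1 hsl
  obtain ⟨hXr, hfr⟩ := h.rel.descend _ _ _ _ sr (h.cod _ hY) (h.cod _ hZ) (h.cod _ hP) hp.2.1 hsr
  have hfstl := h.fst_mem sl hXl hp.1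
  have hfstr := h.fst_mem sr hXr hp.2.1
  have hX : E X.hom := h.of_comp hfstl (Arrow.w fst ▸ h.comp_mem hP hfstr)
  have W := IsPullback.of_hasPullback f.right Z.hom
  let w₁ := pullback.fst f.right Z.hom
  let w₂ := pullback.snd f.right Z.hom
  have hw₁ : E w₁ := h.fst_mem W hXr hZ
  let r : X.left ⟶ pullback f.right Z.hom := pullback.lift X.hom f.left (Arrow.w f).symm
  have hr₁ : r ≫ w₁ = X.hom := pullback.lift_fst _ _ _
  have hr₂ : r ≫ w₂ = f.left := pullback.lift_snd _ _ _
  let ψ : V ⟶ pullback f.right Z.hom := pullback.lift (v₁ ≫ fst.right) (v₂ ≫ p.left) (by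
    rw [Category.assoc, Category.assoc, Arrow.w p, sr.w, s.w_assoc])
  have hψ₁ : ψ ≫ w₁ = v₁ ≫ fst.right := pullback.lift_fst _ _ _
  have hψ₂ : ψ ≫ w₂ = v₂ ≫ p.left := pullback.lift_snd _ _ _
  have hψ : IsPullback v₂ ψ p.left w₂ := by
    refine IsPullback.of_bot (v₂₁ := w₁) (v₂₂ := Z.hom) (h₃₁ := f.right) ?_ hψ₂.symm W.flip
    rw [hψ₁, Arrow.w p]
    exact s.flip.paste_vert sr.flip
  have hψE : E ψ := h.fst_mem hψ.flip (h.dom _ hw₁) hp.1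
  have e : rs ≫ ψ = fst.left ≫ r := by
    apply W.hom_ext
    · change (rs ≫ ψ) ≫ w₁ = (fst.left ≫ r) ≫ w₁
      rw [Category.assoc, Category.assoc, hψ₁, hr₁, reassoc_of% hv₁, Arrow.w fst]
    · change (rs ≫ ψ) ≫ w₂ = (fst.left ≫ r) ≫ w₂
      rw [Category.assoc, Category.assoc, hψ₂, hr₂, reassoc_of% hv₂, sl.w]
  exact ⟨hX, h.doubleClass_of hfl hfr hX hZ W hr₁ hr₂ (h.of_comp hfstl (e ▸ h.comp_mem hrs hψE))⟩

/-- The axioms reproduce themselves one level up: the closure properties come from the comparison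
arguments, the kernel, pullback and descent properties from their components. -/
theorem arrow [HasZeroObject C] :
    IsExtensionClass (fun a : Arrow C => E a.hom) (doubleClass E) where
  rel :=
    { le := le_rfl
      iso := fun _ _ f ha hb _ => h.doubleClass_of_isIso f ha hb
      comp := fun _ _ _ _ _ _ _ _ hf hg => h.doubleClass_comp hf hg
      pullback := fun _ _ _ _ _ _ _ _ sq hX _ _ hg =>
        h.doubleClass_pullback (arrow_isPullback_left sq) (arrow_isPullback_right sq) hX hg
      cancel := fun _ _ _ _ _ _ _ _ hf hfg => h.doubleClass_of_comp hf hfg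
      descend := fun _ _ _ _ _ _ _ _ sq _ _ _ hp hsnd =>
        h.doubleClass_descend (arrow_isPullback_left sq) (arrow_isPullback_right sq) hp hsnd }
  dom := fun _ _ _ hf => hf.2.2.1
  cod := fun _ _ _ hf => hf.2.2.2.1
  ext_of_iso := fun a b f _ ha => by
    have : b.hom = inv f.left ≫ a.hom ≫ f.right := by
      rw [← Arrow.w f, IsIso.inv_hom_id_assoc]
    change E b.hom
    rw [this]
    have hl : ext b.left := h.ext_of_iso f.left inferInstance (h.dom _ ha)
    exact h.comp_mem (h.mem_of_isIso _ hl) (h.comp_mem ha (h.mem_of_isIso _ (h.cod _ ha)))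
  ext_zero := fun Z hZ => h.to_zero _ (h.ext_zero (arrow_isZero_left hZ)) (arrow_isZero_right hZ)
  to_zero := fun a b f ha hb => by
    have hl := arrow_isZero_left hb
    have hr := arrow_isZero_right hb
    have : IsIso b.hom := ⟨0, hl.eq_of_src _ _, hr.eq_of_src _ _⟩
    exact h.doubleClass_of (h.to_zero _ (h.dom _ ha) hl) (h.to_zero _ (h.cod _ ha) hr) ha
      (h.to_zero _ (h.ext_zero hl) hr) (P := a.right) (p₁ := 𝟙 _) (p₂ := 0) (r := a.hom)
      (IsPullback.of_horiz_isIso ⟨hr.eq_of_tgt _ _⟩) (Category.comp_id _) (hl.eq_of_tgt _ _) ha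
  isCokernel := fun _ _ _ _ _ hq hk =>
    arrow_isCokernel (h.isCokernel _ _ hq.1 (arrow_isKernel_left hk))
      (h.isCokernel _ _ hq.2.1 (arrow_isKernel_right hk))
  isPullback_of_isKernel := fun _ _ _ _ _ _ _ _ _ _ hq w hk hk' =>
    arrow_isPullback
      (h.isPullback_of_isKernel _ _ _ _ _ hq.1 (congrArg (·.left) w) (arrow_isKernel_left hk)
        (arrow_isKernel_left hk'))
      (h.isPullback_of_isKernel _ _ _ _ _ hq.2.1 (congrArg (·.right) w) (arrow_isKernel_right hk)
        (arrow_isKernel_right hk'))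
  isBeckDescent := fun _ _ _ hp =>
    arrow_isBeckDescent (h.isBeckDescent _ hp.1) (h.isBeckDescent _ hp.2.1)

end IsExtensionClass

end ExtensionClass

/-! ### The axioms at level zero -/

section Base

variable {A : Type u} [Category.{v} A] [HasZeroMorphisms A]

theorem isRelativeClass_top : IsRelativeClass (⊤ : ObjectProperty A) (normalEpis A) ⊤ where
  le := le_top
  iso _ _ _ _ _ _ := trivial
  comp _ _ _ _ _ _ _ _ _ _ := trivial
  pullback _ _ _ _ _ _ _ _ _ _ _ _ _ := ⟨trivial, trivial⟩
  cancel _ _ _ _ _ _ _ _ _ _ := trivial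
  descend _ _ _ _ _ _ _ _ _ _ _ _ _ _ := ⟨trivial, trivial⟩

theorem isExtensionClass_normalEpis [Homological A]
    (hdesc : ∀ ⦃X Y : A⦄ (f : X ⟶ Y), Nonempty (NormalEpi f) → IsEffectiveDescent f) :
    IsExtensionClass (⊤ : ObjectProperty A) (normalEpis A) where
  rel :=
    { le := le_rfl
      iso := fun _ _ f _ _ _ => normalEpi_of_isIso f
      comp := fun _ _ _ _ _ _ _ _ hf hg => normalEpi_comp hf hg
      pullback := fun _ _ _ _ _ _ _ _ sq _ _ _ hg => ⟨trivial, normalEpi_of_isPullback sq hg⟩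
      cancel := fun _ _ _ _ _ _ _ _ _ hfg => normalEpi_of_comp hfg
      descend := fun _ _ _ _ fst snd f p sq _ _ _ hp hs =>
        ⟨trivial, normalEpi_of_comp (f := fst) (by rw [sq.w]; exact normalEpi_comp hs hp)⟩ }
  dom _ _ _ _ := trivial
  cod _ _ _ _ := trivial
  ext_of_iso _ _ _ _ _ := trivial
  ext_zero _ _ := trivial
  to_zero X Z f _ hZ := by
    refine IsCokernel.normalEpi (k := 𝟙 X) (isCokernel_iff.2 ⟨hZ.eq_of_tgt _ _,
      ⟨fun _ _ _ => hZ.eq_of_src _ _⟩, fun W g hg => ⟨0, ?_⟩⟩)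
    rw [comp_zero, ← hg, Category.id_comp]
  isCokernel _ _ _ k _ hq hk := normalEpi_iff.1 hq k hk
  isPullback_of_isKernel _ _ _ _ _ _ _ _ _ _ hq w hk hk' :=
    isPullback_of_isKernel (isBeckDescent_of_isEffectiveDescent (hdesc _ hq)) w hk hk'
  isBeckDescent _ _ _ hp := isBeckDescent_of_isEffectiveDescent (hdesc _ hp)

end Base

/-! ### Pullbacks along the Galois class in the category of extensions -/

section RelativeClass

variable {C : Type u} [Category.{v} C] [HasPullbacks C] {ext : ObjectProperty C}
  {E Q : MorphismProperty C}

namespace IsRelativeClass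

variable (hQ : IsRelativeClass ext E Q)

include hQ

theorem isPullback_hom {P X Y Z : ext.FullSubcategory}
    {fst : P ⟶ X} {snd : P ⟶ Y} {f : X ⟶ Z} {g : Y ⟶ Z} (sq : IsPullback fst snd f g)
    (hg : Q g.hom) : IsPullback fst.hom snd.hom f.hom g.hom := by
  have sq' := IsPullback.of_hasPullback f.hom g.hom
  exact isPullback_hom_of_exists sq sq'
    (hQ.pullback _ _ _ _ sq' X.property Y.property Z.property hg).1

omit [HasPullbacks C] in
theorem isStableUnderComposition : (Q.inverseImage ext.ι).IsStableUnderComposition where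
  comp_mem {X Y Z} f g hf hg := hQ.comp f.hom g.hom X.property Y.property Z.property hf hg

theorem isStableUnderBaseChange : (Q.inverseImage ext.ι).IsStableUnderBaseChange where
  of_isPullback sq hg :=
    (hQ.pullback _ _ _ _ (hQ.isPullback_hom sq.flip hg) (ObjectProperty.FullSubcategory.property _)
      (ObjectProperty.FullSubcategory.property _) (ObjectProperty.FullSubcategory.property _) hg).2

end IsRelativeClass

end RelativeClass

/-! ### Torsion theories of extensions and their Galois theory -/

section ExtTorsion

variable {C : Type u} [Category.{v} C] [HasZeroMorphisms C]

/-- A torsion theory in the full subcategory of extensions `ext`, all of whose reflection units lie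
in the class `E`. -/
structure IsExtTorsion (ext : ObjectProperty C) (E : MorphismProperty C)
    (T F : ObjectProperty C) : Prop where
  torsion_le : T ≤ ext
  torsionFree_le : F ≤ ext
  replete_torsion : T.IsClosedUnderIsomorphisms
  replete_torsionFree : F.IsClosedUnderIsomorphisms
  hom_eq_zero : ∀ ⦃X Y : C⦄, T X → F Y → ∀ f : X ⟶ Y, f = 0
  exists_isKernel : ∀ X : C, ext X → ∃ (S X' : C) (t : S ⟶ X) (q : X ⟶ X'),
    T S ∧ F X' ∧ E q ∧ IsKernel t q

theorem fullSubcategory_isKernel {ext : ObjectProperty C} {K X Y : ext.FullSubcategory}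
    {k : K ⟶ X} {f : X ⟶ Y} (h : IsKernel k.hom f.hom) : IsKernel k f := by
  have := h.mono
  refine isKernel_iff.2 ⟨ObjectProperty.hom_ext _ h.zero, ⟨fun a b hab => ?_⟩, fun Z g hg => ?_⟩
  · exact ObjectProperty.hom_ext _ ((cancel_mono k.hom).1 (congrArg (·.hom) hab))
  · obtain ⟨l, hl⟩ := h.lift g.hom (congrArg (·.hom) hg)
    exact ⟨ObjectProperty.homMk l, ObjectProperty.hom_ext _ hl⟩

theorem fullSubcategory_isCokernel {ext : ObjectProperty C} {K X Y : ext.FullSubcategory}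
    {k : K ⟶ X} {f : X ⟶ Y} (h : IsCokernel k.hom f.hom) : IsCokernel k f := by
  have := h.epi
  refine isCokernel_iff.2 ⟨ObjectProperty.hom_ext _ h.zero, ⟨fun a b hab => ?_⟩, fun Z g hg => ?_⟩
  · exact ObjectProperty.hom_ext _ ((cancel_epi f.hom).1 (congrArg (·.hom) hab))
  · obtain ⟨l, hl⟩ := h.desc g.hom (congrArg (·.hom) hg)
    exact ⟨ObjectProperty.homMk l, ObjectProperty.hom_ext _ hl⟩

namespace IsExtTorsion

variable {ext : ObjectProperty C} {E Q : MorphismProperty C} {T F : ObjectProperty C}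
  (h : IsExtTorsion ext E T F) (hE : IsExtensionClass ext E)

include h

theorem isCoreflection {S X X' : C} {t : S ⟶ X} {q : X ⟶ X'} (hS : T S) (hX' : F X')
    (ht : IsKernel t q) : IsCoreflection T t where
  mem := hS
  existsUnique Z hZ g := by
    have := ht.mono
    obtain ⟨l, hl⟩ := ht.lift g (h.hom_eq_zero hZ hX' _)
    exact ⟨l, hl, fun l' hl' => (cancel_mono t).1 (hl'.trans hl.symm)⟩

include hE

theorem isReflection {X X' : ext.FullSubcategory} {S : C} {t : S ⟶ X.obj} {q : X ⟶ X'} (hS : T S)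
    (hX' : F X'.obj) (hq : E q.hom) (ht : IsKernel t q.hom) :
    IsReflection (F.inverseImage ext.ι) q where
  mem := hX'
  existsUnique Z hZ g := by
    have hc := hE.isCokernel _ _ hq ht
    have := hc.epi
    obtain ⟨l, hl⟩ := hc.desc g.hom (h.hom_eq_zero hS hZ _)
    refine ⟨ObjectProperty.homMk l, ObjectProperty.hom_ext _ hl, fun l' hl' => ?_⟩
    refine ObjectProperty.hom_ext _ ((cancel_epi q.hom).1 ?_)
    exact (congrArg (·.hom) hl').trans hl.symm

/-- Reflections are unique up to isomorphism, so every unit inherits the properties of the one given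
by `exists_isKernel`. -/
theorem exists_isKernel_of_isReflection {X X' : ext.FullSubcategory} {η : X ⟶ X'}
    (hη : IsReflection (F.inverseImage ext.ι) η) :
    E η.hom ∧ ∃ (S : C) (t : S ⟶ X.obj), T S ∧ IsKernel t η.hom := by
  obtain ⟨S, Y, t, q, hS, hY, hq, ht⟩ := h.exists_isKernel X.obj X.property
  let Y' : ext.FullSubcategory := ⟨Y, h.torsionFree_le _ hY⟩
  let q' : X ⟶ Y' := ObjectProperty.homMk q
  have hq' : IsReflection (F.inverseImage ext.ι) q' := h.isReflection hE hS hY hq ht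
  obtain ⟨a, ha, -⟩ := hq'.existsUnique hη.mem η
  obtain ⟨b, hb, -⟩ := hη.existsUnique hq'.mem q'
  have hab : a ≫ b = 𝟙 _ := (hq'.existsUnique hq'.mem q').unique
    (by rw [reassoc_of% ha, hb]) (Category.comp_id _)
  have hba : b ≫ a = 𝟙 _ := (hη.existsUnique hη.mem η).unique
    (by rw [reassoc_of% hb, ha]) (Category.comp_id _)
  have hia : IsIso a := ⟨b, hab, hba⟩
  have hia' : IsIso a.hom := inferInstanceAs (IsIso (ext.ι.map a))
  have ha' : η.hom = q ≫ a.hom := congrArg (·.hom) ha.symm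
  rw [ha']
  refine ⟨hE.comp_mem hq (hE.mem_of_isIso _ Y'.property), S, t, hS, isKernel_iff.2
    ⟨by rw [reassoc_of% ht.zero, zero_comp], ht.mono, fun Z g hg => ht.lift g ?_⟩⟩
  rw [← cancel_mono a.hom, Category.assoc, hg, zero_comp]

theorem isTorsionTheory [HasZeroObject C] :
    IsTorsionTheory (T.inverseImage ext.ι) (F.inverseImage ext.ι) where
  pointed := by
    obtain ⟨Z, hZ⟩ := HasZeroObject.zero (C := C)
    refine ⟨⟨⟨Z, hE.ext_zero hZ⟩, ?_⟩⟩
    rw [IsZero.iff_id_eq_zero]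
    exact ObjectProperty.hom_ext _ (hZ.eq_of_src _ _)
  replete_torsion := by
    have := h.replete_torsion
    infer_instance
  replete_torsionFree := by
    have := h.replete_torsionFree
    infer_instance
  hom_eq_zero X Y hX hY f := ObjectProperty.hom_ext _ (h.hom_eq_zero hX hY _)
  exists_shortExact X := by
    obtain ⟨S, Y, t, q, hS, hY, hq, ht⟩ := h.exists_isKernel X.obj X.property
    exact ⟨⟨S, h.torsion_le _ hS⟩, ⟨Y, h.torsionFree_le _ hY⟩, ObjectProperty.homMk t,
      ObjectProperty.homMk q, hS, hY, fullSubcategory_isKernel ht,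
      fullSubcategory_isCokernel (hE.isCokernel _ _ hq ht)⟩

variable [HasPullbacks C] (hQ : IsRelativeClass ext E Q)

include hQ

/-- `E` contains the units, while `Q` is the possibly larger Galois class: all morphisms at level
zero, equal to `E` afterwards. -/
theorem isAdmissibleGaloisStructure :
    IsAdmissibleGaloisStructure (F.inverseImage ext.ι) (Q.inverseImage ext.ι) where
  replete := by
    have := h.replete_torsionFree
    infer_instance
  reflective X := by
    obtain ⟨S, Y, t, q, hS, hY, hq, ht⟩ := h.exists_isKernel X.obj X.property
    exact ⟨⟨Y, h.torsionFree_le _ hY⟩, ObjectProperty.homMk q, h.isReflection hE hS hY hq ht⟩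
  hasPullback X Y Z f g hg := by
    have sq := IsPullback.of_hasPullback f.hom g.hom
    have hP := (hQ.pullback _ _ _ _ sq X.property Y.property Z.property hg).1
    exact (fullSubcategory_isPullback (P := ⟨_, hP⟩) (fst := ObjectProperty.homMk _)
      (snd := ObjectProperty.homMk _) sq).hasPullback
  isos X Y f _ := hQ.iso _ X.property Y.property (inferInstanceAs (IsIso (ext.ι.map f)))
  comp := hQ.isStableUnderComposition
  baseChange := hQ.isStableUnderBaseChange
  reflector_mem X Y X' Y' f ηX ηY f' hX hY w hf := by
    refine hQ.cancel ηX.hom f'.hom X.property X'.property Y'.property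
      (h.exists_isKernel_of_isReflection hE hX).1 ?_
    rw [show ηX.hom ≫ f'.hom = f.hom ≫ ηY.hom from congrArg (·.hom) w]
    exact hQ.comp _ _ X.property Y.property Y'.property hf
      (hQ.le _ (h.exists_isKernel_of_isReflection hE hY).1)
  fullyFaithful B B' X Y U V η φ ψ u₁ u₂ v₁ v₂ hη hX hY hφ hψ hU hV a ha := by
    obtain ⟨hηE, S, t, hS, ht⟩ := h.exists_isKernel_of_isReflection hE hη
    have hU' := hQ.isPullback_hom hU hφ
    have hu₂ : E u₂.hom := hE.fst_mem hU'.flip X.property hηE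
    -- The pullback `u₂` of the unit is again in `E` with the torsion kernel S. A morphism from U to
    -- the torsion-free Y kills S and hence factors uniquely through `u₂`.
    let j : S ⟶ U.obj := hU'.lift t 0 (by rw [ht.zero, zero_comp])
    have hj : IsKernel j u₂.hom := ht.of_isPullback hU' (hU'.lift_fst _ _ _) (hU'.lift_snd _ _ _)
    have hc := hE.isCokernel _ _ hu₂ hj
    have := hc.epi
    obtain ⟨b, hb⟩ := hc.desc (a.hom ≫ v₂.hom) (h.hom_eq_zero hS hY _)
    refine ⟨ObjectProperty.homMk b, ⟨?_, ObjectProperty.hom_ext _ hb.symm⟩, fun b' hb' => ?_⟩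
    · refine ObjectProperty.hom_ext _ ((cancel_epi u₂.hom).1 ?_)
      change u₂.hom ≫ b ≫ ψ.hom = u₂.hom ≫ φ.hom
      rw [reassoc_of% hb, ← hU'.w,
        show v₂.hom ≫ ψ.hom = v₁.hom ≫ η.hom from congrArg (·.hom) hV.w.symm, ← Category.assoc]
      exact congrArg (fun m => m.hom ≫ η.hom) ha
    · refine ObjectProperty.hom_ext _ ((cancel_epi u₂.hom).1 ?_)
      exact (congrArg (·.hom) hb'.2).symm.trans hb.symm

/-- The right-hand side says that the kernel of f is torsion-free without requiring that kernel to
be named. The hypothesis `hsplit` is the only trace of (P). -/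
theorem isNormalExtension_iff
    (hsplit : ∀ ⦃R X S S' : C⦄ (p : R ⟶ X) (s : X ⟶ R) (t : S ⟶ R) (t' : S' ⟶ X), ext R → ext X →
      s ≫ p = 𝟙 X → IsCoreflection T t → IsCoreflection T t' →
      (∀ ⦃Z : C⦄ (u : Z ⟶ R), T Z → u ≫ p = 0 → u = 0) →
      ∃ e : S ⟶ S', IsIso e ∧ e ≫ t' = t ≫ p)
    {X Y : ext.FullSubcategory} (f : X ⟶ Y) (hf : E f.hom) :
    IsNormalExtension (F.inverseImage ext.ι) (Q.inverseImage ext.ι) f ↔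
      ∀ ⦃Z : C⦄ (u : Z ⟶ X.obj), T Z → u ≫ f.hom = 0 → u = 0 := by
  have hQf := hQ.le _ hf
  constructor
  · rintro ⟨-, R, p₁, p₂, sq, -, R', X', q, q', p', hq, hq', sq'⟩ Z u hZ hu
    -- The pair (0, u) into the kernel pair is killed by the first projection, and by the unit
    -- because Z is torsion. These are jointly monic when the naturality square is a pullback.
    have hsq := hQ.isPullback_hom sq hQf
    let m : Z ⟶ R.obj := hsq.lift 0 u (by rw [zero_comp, hu])
    have hm : m = 0 := by
      let m' : (⟨Z, h.torsion_le _ hZ⟩ : ext.FullSubcategory) ⟶ R := ObjectProperty.homMk m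
      have : m' = 0 := by
        apply sq'.hom_ext
        · exact ObjectProperty.hom_ext _ ((h.hom_eq_zero hZ hq.mem _).trans zero_comp.symm)
        · exact ObjectProperty.hom_ext _ ((hsq.lift_fst _ _ _).trans zero_comp.symm)
      exact congrArg (·.hom) this
    rw [← hsq.lift_snd 0 u (by rw [zero_comp, hu])]
    change m ≫ _ = 0
    rw [hm, zero_comp]
  · intro H
    have hmon : IsMonadicExtension (Q.inverseImage ext.ι) f :=
      isMonadicExtension_of_isBeckDescent f hQf hQ.isStableUnderComposition
        (fun P Z fst snd g hZ hg sq => by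
          have hP := (hQ.pullback _ _ _ _ sq hZ X.property Y.property hQf).1
          exact ⟨hP, (hQ.pullback _ _ _ _ sq.flip X.property hZ Y.property hg).2⟩)
        (fun P Z fst snd g hP hs sq =>
          hQ.descend _ _ _ _ sq X.property Y.property hP hf hs)
        (hE.isBeckDescent _ hf)
    refine ⟨hmon, ?_⟩
    have sq := IsPullback.of_hasPullback f.hom f.hom
    have hp₁ : E (pullback.fst f.hom f.hom) := hE.fst_mem sq X.property hf
    have hR := hE.dom _ hp₁
    let R : ext.FullSubcategory := ⟨_, hR⟩
    let p₁ : R ⟶ X := ObjectProperty.homMk (pullback.fst f.hom f.hom)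
    let p₂ : R ⟶ X := ObjectProperty.homMk (pullback.snd f.hom f.hom)
    refine ⟨R, p₁, p₂, fullSubcategory_isPullback sq, hQ.le _ hp₁, ?_⟩
    obtain ⟨S, R', t, q, hS, hR', hq, ht⟩ := h.exists_isKernel R.obj R.property
    obtain ⟨S', X', t', q', hS', hX', hq', ht'⟩ := h.exists_isKernel X.obj X.property
    obtain ⟨p', hp'⟩ := (hE.isCokernel _ _ hq ht).desc (p₁.hom ≫ q') (h.hom_eq_zero hS hX' _)
    let d : X.obj ⟶ R.obj := pullback.lift (𝟙 _) (𝟙 _) rfl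
    have hd : d ≫ p₁.hom = 𝟙 _ := pullback.lift_fst _ _ _
    -- The diagonal splits the first projection. A torsion morphism killed by that projection is
    -- determined by its second component, which f kills, so it vanishes by `H`.
    obtain ⟨e, he, het⟩ := hsplit p₁.hom d t t' R.property X.property hd
      (h.isCoreflection hS hR' ht) (h.isCoreflection hS' hX' ht') (fun Z u hZ hu => by
        apply sq.hom_ext
        · exact hu.trans zero_comp.symm
        · rw [zero_comp]
          refine H _ hZ ?_
          rw [Category.assoc, ← sq.w, ← Category.assoc]
          exact (congrArg (· ≫ f.hom) hu).trans zero_comp)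
    refine ⟨⟨R', h.torsionFree_le _ hR'⟩, ⟨X', h.torsionFree_le _ hX'⟩, ObjectProperty.homMk q,
      ObjectProperty.homMk q', ObjectProperty.homMk p', h.isReflection hE hS hR' hq ht,
      h.isReflection hE hS' hX' hq' ht', fullSubcategory_isPullback ?_⟩
    exact hE.isPullback_of_isKernel q q' p₁.hom p' t hq hp' ht (het ▸ ht'.comp_iso e)

end IsExtTorsion

end ExtTorsion

/-! ### Uniqueness of coreflections -/

section

variable {C : Type u} [Category.{v} C]

theorem IsCoreflection.exists_isIso {T : ObjectProperty C} {S S' X : C} {t : S ⟶ X} {t' : S' ⟶ X}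
    (h : IsCoreflection T t) (h' : IsCoreflection T t') :
    ∃ a : S ⟶ S', IsIso a ∧ a ≫ t' = t := by
  obtain ⟨a, ha, -⟩ := h'.existsUnique h.mem t
  obtain ⟨b, hb, -⟩ := h.existsUnique h'.mem t'
  exact ⟨a, ⟨b, (h.existsUnique h.mem t).unique
    (by rw [Category.assoc, hb, ha]) (Category.id_comp _), (h'.existsUnique h'.mem t').unique
    (by rw [Category.assoc, ha, hb]) (Category.id_comp _)⟩, ha⟩

end

/-! ### Torsion theories in the base category and protoadditivity -/

section TorsionTheory

variable {A : Type u} [Category.{v} A] [HasZeroMorphisms A] {T F : ObjectProperty A}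

namespace IsTorsionTheory

variable (h : IsTorsionTheory T F)

include h

theorem isCoreflection {S X Y : A} {t : S ⟶ X} {q : X ⟶ Y} (hS : T S) (hY : F Y)
    (ht : IsKernel t q) : IsCoreflection T t where
  mem := hS
  existsUnique Z hZ g := by
    have := ht.mono
    obtain ⟨l, hl⟩ := ht.lift g (h.hom_eq_zero hZ hY _)
    exact ⟨l, hl, fun l' hl' => (cancel_mono t).1 (hl'.trans hl.symm)⟩

theorem isShortExact {S X : A} {t : S ⟶ X} (ht : IsCoreflection T t) :
    ∃ (Y : A) (q : X ⟶ Y), F Y ∧ IsShortExact t q := by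
  obtain ⟨S', Y, t', q, hS', hY, ht', hq⟩ := h.exists_shortExact X
  refine ⟨Y, q, hY, ?_⟩
  have hc := h.isCoreflection hS' hY ht'
  obtain ⟨a, _, ha⟩ := ht.exists_isIso hc
  refine ⟨ha ▸ ht'.comp_iso a, isCokernel_iff.2
    ⟨by rw [← ha, Category.assoc, hq.zero, comp_zero], hq.epi, fun Z g hg => hq.desc g ?_⟩⟩
  rw [← cancel_epi a, reassoc_of% ha, hg, comp_zero]

theorem exists_isCoreflection (X : A) : ∃ (S : A) (t : S ⟶ X), IsCoreflection T t := by
  obtain ⟨S, Y, t, q, hS, hY, ht, -⟩ := h.exists_shortExact X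
  exact ⟨S, t, h.isCoreflection hS hY ht⟩

theorem mono_of_isCoreflection {S X : A} {t : S ⟶ X} (ht : IsCoreflection T t) : Mono t := by
  obtain ⟨Y, q, -, hk, -⟩ := h.isShortExact ht
  exact hk.mono

theorem torsionFree_of_isCokernel {S X Y : A} {t : S ⟶ X} {q : X ⟶ Y} (ht : IsCoreflection T t)
    (hq : IsCokernel t q) : F Y := by
  obtain ⟨Y', q', hY', -, hq'⟩ := h.isShortExact ht
  have := hq.epi
  have := hq'.epi
  obtain ⟨a, ha⟩ := hq.desc q' hq'.zero
  obtain ⟨b, hb⟩ := hq'.desc q hq.zero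
  have e : Y ≅ Y' := ⟨a, b, by rw [← cancel_epi q, reassoc_of% ha, hb, Category.comp_id],
    by rw [← cancel_epi q', reassoc_of% hb, ha, Category.comp_id]⟩
  have := h.replete_torsionFree
  exact F.prop_of_iso e.symm hY'

theorem torsionFree_iff {X : A} : F X ↔ ∀ ⦃Z : A⦄ (u : Z ⟶ X), T Z → u = 0 := by
  refine ⟨fun hX Z u hZ => h.hom_eq_zero hZ hX u, fun H => ?_⟩
  obtain ⟨S, Y, t, q, hS, hY, -, hq⟩ := h.exists_shortExact X
  obtain ⟨l, hl⟩ := hq.desc (𝟙 X) (by rw [H t hS, zero_comp])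
  have := hq.epi
  have := h.replete_torsionFree
  exact F.prop_of_iso (Iso.symm ⟨q, l, hl, by rw [← cancel_epi q, reassoc_of% hl, Category.comp_id]⟩)
    hY

/-- If the reflector is protoadditive, then a split epimorphism with torsion-free kernel induces
an isomorphism between the torsion parts. -/
theorem exists_iso_of_split (hA : Homological A) (hP : ConditionP F) {R X S S' : A} (p : R ⟶ X)
    (s : X ⟶ R) (t : S ⟶ R) (t' : S' ⟶ X) (hs : s ≫ p = 𝟙 X) (ht : IsCoreflection T t)
    (ht' : IsCoreflection T t') (H : ∀ ⦃Z : A⦄ (u : Z ⟶ R), T Z → u ≫ p = 0 → u = 0) :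
    ∃ e : S ⟶ S', IsIso e ∧ e ≫ t' = t ≫ p := by
  obtain ⟨G, ⟨adj⟩, hG⟩ := hP
  obtain ⟨K, k, hk⟩ := exists_isKernel p
  have := hk.mono
  have hK : F K := h.torsionFree_iff.2 fun Z u hZ => by
    rw [← cancel_mono k, zero_comp]
    exact H _ hZ (by rw [Category.assoc, hk.zero, comp_zero])
  obtain ⟨e, he, -⟩ := ht'.existsUnique ht.mem (t ≫ p)
  obtain ⟨i, hi, -⟩ := ht.existsUnique ht'.mem (t' ≫ s)
  have hie : i ≫ e = 𝟙 _ := (ht'.existsUnique ht'.mem t').unique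
    (by rw [Category.assoc, he, reassoc_of% hi, hs, Category.comp_id]) (Category.id_comp _)
  refine ⟨e, isIso_of_split_of_kernel e i hie fun Z z hz => ?_, he⟩
  have := h.mono_of_isCoreflection ht
  -- It remains to see that a morphism `z` killed by `e` vanishes. It factors through K as `l`, and
  -- its image in the reflection of R is zero because S is torsion. Protoadditivity makes the
  -- reflection of `k` monic, and the unit at the torsion-free K is monic, so `l` = 0.
  obtain ⟨l, hl⟩ := hk.lift (z ≫ t) (by rw [Category.assoc, ← he, reassoc_of% hz, zero_comp])
  rw [← cancel_mono t, zero_comp, ← hl]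
  have hmono : Mono (G.map k) := (hG k p s ⟨hk, hs⟩).1.mono
  have : F.ι.PreservesMonomorphisms := F.ι.preservesMonomorphisms_of_adjunction adj
  have hmono' : Mono (F.ι.map (G.map k)) := inferInstance
  have hη : Mono (adj.unit.app K) :=
    SplitMono.mono ⟨F.ι.map ((adj.homEquiv K ⟨K, hK⟩).symm (𝟙 K)), by
      have := (adj.homEquiv K ⟨K, hK⟩).apply_symm_apply (𝟙 K)
      rwa [adj.homEquiv_unit] at this⟩
  have key : l ≫ adj.unit.app K ≫ F.ι.map (G.map k) = 0 := by
    have hn := adj.unit.naturality k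
    have ht0 : t ≫ adj.unit.app R = 0 := h.hom_eq_zero ht.mem (G.obj R).property _
    simp only [Functor.id_map, Functor.comp_map] at hn
    rw [← hn, reassoc_of% hl, ht0, comp_zero]
  have hl0 : l = 0 := by
    rw [← cancel_mono (adj.unit.app K), ← cancel_mono (F.ι.map (G.map k)), Category.assoc, key,
      zero_comp, zero_comp]
  rw [hl0, zero_comp]

end IsTorsionTheory

end TorsionTheory

/-! ### Normal monomorphisms as kernels of normal epimorphisms -/

section Image

variable {A : Type u} [Category.{v} A] [HasZeroMorphisms A] [Homological A]

/-- Every normal monomorphism is the kernel of a normal epimorphism. -/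
theorem exists_normalEpi_of_normalMono {S X : A} (u : S ⟶ X) (hu : Nonempty (NormalMono u)) :
    ∃ (X' : A) (q : X ⟶ X'), Nonempty (NormalEpi q) ∧ IsKernel u q := by
  obtain ⟨⟨W, g, w, hl⟩⟩ := hu
  have hk : IsKernel u g := ⟨w, ⟨hl⟩⟩
  -- The kernel of g is also the kernel of the strong epimorphism onto its image.
  let M := Regular.strongEpiMonoFactorisation g
  refine ⟨M.I, M.e, normalEpi_of_isRegularEpi _, isKernel_iff.2 ⟨?_, hk.mono, fun Z z hz => ?_⟩⟩
  · rw [← cancel_mono M.m, Category.assoc, M.fac, hk.zero, zero_comp]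
  · exact hk.lift z (by rw [← M.fac, reassoc_of% hz, zero_comp])

end Image

theorem comp_prod_lift_eq_zero_iff {C : Type u} [Category.{v} C] [HasZeroMorphisms C]
    [HasBinaryProducts C] {W X Y Z : C} (v : W ⟶ X) (f : X ⟶ Y) (g : X ⟶ Z) :
    v ≫ prod.lift f g = 0 ↔ v ≫ f = 0 ∧ v ≫ g = 0 := by
  constructor
  · intro h
    constructor
    · rw [← prod.lift_fst f g, ← Category.assoc, h, zero_comp]
    · rw [← prod.lift_snd f g, ← Category.assoc, h, zero_comp]
  · rintro ⟨h₁, h₂⟩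
    apply Limits.prod.hom_ext
    · rw [Category.assoc, prod.lift_fst, h₁, zero_comp]
    · rw [Category.assoc, prod.lift_snd, h₂, zero_comp]

/-! ### The inductive invariant and rib kernels -/

namespace Level

section

variable {A : Type u} [Category.{v} A] (L : Level.{w} A)

/-- `κ` is a universal morphism from the functor `ιⁿ` to `X`. -/
def IsUniversal {K : A} {X : L.Obj} (κ : L.iota.obj K ⟶ X) : Prop :=
  ∀ ⦃S : A⦄ (g : L.iota.obj S ⟶ X), ∃! l : S ⟶ K, L.iota.map l ≫ κ = g

variable [HasZeroMorphisms A]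

/-- The properties of the category of `n`-fold morphisms from which the theory of `(n + 1)`-fold
extensions is developed. -/
structure IsRegular (T F : ObjectProperty A) (e : 𝟭 A ⟶ L.iota ⋙ L.top) : Prop where
  hasFiniteLimits : HasFiniteLimits L.Obj
  isExtensionClass : IsExtensionClass L.ext L.cls
  isRelativeClass : IsRelativeClass L.ext L.cls L.galoisCls
  full : L.iota.Full
  faithful : L.iota.Faithful
  top_zero : ∀ X Y : L.Obj, L.top.map (0 : X ⟶ Y) = 0
  ext_iota : ∀ S, L.ext (L.iota.obj S)
  hom_ext : ∀ ⦃S : A⦄ ⦃X : L.Obj⦄ (f g : L.iota.obj S ⟶ X),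
    e.app S ≫ L.top.map f = e.app S ≫ L.top.map g → f = g
  exists_iff : ∀ ⦃S : A⦄ ⦃X : L.Obj⦄ (v : S ⟶ L.top.obj X),
    (∃ f : L.iota.obj S ⟶ X, e.app S ≫ L.top.map f = v) ↔
      ∀ a ∈ L.ribs X, v ≫ Under.hom a = 0
  torsionFree_iff : ∀ X, L.torsionFree X ↔ ∀ ⦃S : A⦄ (f : L.iota.obj S ⟶ X), T S → f = 0
  normalExt_iff : ∀ X, L.normalExt X ↔
    L.ext X ∧ ∀ ⦃S : A⦄ (f : L.iota.obj S ⟶ X), T S → f = 0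
  exists_cls_isKernel : ∀ ⦃S : A⦄ ⦃X : L.Obj⦄ (f : L.iota.obj S ⟶ X), L.ext X →
    Nonempty (NormalMono (e.app S ≫ L.top.map f)) → ∃ (X' : L.Obj) (q : X ⟶ X'),
      L.cls q ∧ IsKernel f q
  normalEpi_of_isUniversal : ∀ ⦃K K' : A⦄ ⦃X X' : L.Obj⦄ (κ : L.iota.obj K ⟶ X)
    (κ' : L.iota.obj K' ⟶ X') (q : X ⟶ X') (l : K ⟶ K'), L.IsUniversal κ → L.IsUniversal κ' →
    L.cls q → L.iota.map l ≫ κ' = κ ≫ q → Nonempty (NormalEpi l)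

variable {L}

theorem foldr_ribs_factors [HasFiniteLimits A] {X S : A} (v : S ⟶ X) (l : List (Under X)) :
    (l.foldr (fun a S => kernelSubobject (Under.hom a) ⊓ S) (⊤ : Subobject X)).Factors v ↔
      ∀ a ∈ l, v ≫ Under.hom a = 0 := by
  induction l with
  | nil => simp [Subobject.top_factors]
  | cons a l ih =>
    rw [List.foldr_cons, Subobject.inf_factors, kernelSubobject_factors_iff, ih,
      List.forall_mem_cons]

/-- Condition (N) speaks of the kernel of one morphism; an intersection of kernels is the kernel of
the induced morphism into the product of the codomains. -/
theorem foldr_ribs_isKernel [HasZeroObject A] [HasFiniteLimits A] {X : A} (l : List (Under X)) :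
    ∃ (Y : A) (f : X ⟶ Y), IsKernel
      (l.foldr (fun a S => kernelSubobject (Under.hom a) ⊓ S) (⊤ : Subobject X)).arrow f := by
  suffices H : ∃ (Y : A) (f : X ⟶ Y), ∀ ⦃Z : A⦄ (v : Z ⟶ X),
      v ≫ f = 0 ↔ ∀ a ∈ l, v ≫ Under.hom a = 0 by
    obtain ⟨Y, f, H⟩ := H
    refine ⟨Y, f, isKernel_iff.2 ⟨?_, inferInstance, fun Z g hg => ?_⟩⟩
    · rw [H, ← foldr_ribs_factors]
      exact Subobject.factors_self _
    · rw [H, ← foldr_ribs_factors] at hg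
      exact ⟨_, Subobject.factorThru_arrow _ _ hg⟩
  induction l with
  | nil =>
    obtain ⟨Z, hZ⟩ := HasZeroObject.zero (C := A)
    exact ⟨Z, 0, by simp⟩
  | cons a l ih =>
    obtain ⟨Y, f, hf⟩ := ih
    refine ⟨a.right ⨯ Y, prod.lift (Under.hom a) f, fun Z v => ?_⟩
    rw [comp_prod_lift_eq_zero_iff, hf, List.forall_mem_cons]

end

end Level

namespace Level

variable {A : Type u} [Category.{v} A] {L : Level.{w} A}

theorem unit_naturality (e : 𝟭 A ⟶ L.iota ⋙ L.top) {S S' : A} {X : L.Obj} (l : S ⟶ S')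
    (f : L.iota.obj S' ⟶ X) :
    e.app S ≫ L.top.map (L.iota.map l ≫ f) = l ≫ e.app S' ≫ L.top.map f := by
  have := e.naturality l
  simp only [Functor.id_map, Functor.comp_map] at this
  rw [L.top.map_comp, ← Category.assoc, ← this, Category.assoc]

/-- Passes between the objects ιⁿS and the replete image of 𝒯. -/
theorem forall_map_eq_zero_iff {T : ObjectProperty A} {X : L.Obj} {p : ∀ ⦃Z : L.Obj⦄, (Z ⟶ X) → Prop}
    (hp : ∀ ⦃Z Z' : L.Obj⦄ (f : Z' ⟶ Z) (u : Z ⟶ X), p u → p (f ≫ u)) :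
    (∀ ⦃S : A⦄ (f : L.iota.obj S ⟶ X), T S → p f → f = 0) ↔
      ∀ ⦃Z : L.Obj⦄ (u : Z ⟶ X), T.map L.iota Z → p u → u = 0 := by
  constructor
  · rintro H Z u ⟨S, hS, ⟨i⟩⟩ hu
    rw [← cancel_epi i.hom, H _ hS (hp _ _ hu), comp_zero]
  · intro H S f hS hf
    exact H f (T.prop_map_obj _ hS) hf

end Level

/-! ### Consequences of the invariant at a fixed level -/

namespace Level.IsRegular

variable {A : Type u} [Category.{v} A] [HasZeroMorphisms A] [Homological A] {L : Level.{w} A}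
  {T F : ObjectProperty A} {e : 𝟭 A ⟶ L.iota ⋙ L.top} (h : L.IsRegular T F e)

include h

omit [Homological A] in
theorem map_zero_comp {S S' : A} {X : L.Obj} (f : L.iota.obj S' ⟶ X) :
    L.iota.map (0 : S ⟶ S') ≫ f = 0 := by
  apply h.hom_ext
  rw [unit_naturality, zero_comp, h.top_zero, comp_zero]

/-- By `exists_iff`, both the existence of κ and its universality say that a morphism to the initial
vertex factors through the rib kernel exactly when every rib kills it. -/
theorem exists_isUniversal (X : L.Obj) :
    ∃ κ : L.iota.obj (L.ribKernel X : A) ⟶ X, L.IsUniversal κ ∧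
      e.app _ ≫ L.top.map κ = (L.ribKernel X).arrow := by
  obtain ⟨κ, hκ⟩ := (h.exists_iff (L.ribKernel X).arrow).2
    ((foldr_ribs_factors _ _).1 (Subobject.factors_self _))
  refine ⟨κ, fun S g => ?_, hκ⟩
  have hg := (foldr_ribs_factors _ _).2 ((h.exists_iff _).1 ⟨g, rfl⟩)
  refine ⟨Subobject.factorThru (L.ribKernel X) _ hg, h.hom_ext _ _ ?_, fun l hl => ?_⟩
  · rw [unit_naturality, hκ]
    exact Subobject.factorThru_arrow _ _ _
  · rw [← cancel_mono (L.ribKernel X).arrow]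
    refine Eq.trans ?_ (Subobject.factorThru_arrow _ _ _).symm
    rw [← hl, unit_naturality, hκ]

variable (hTF : IsTorsionTheory T F)

omit [Homological A] in
theorem eq_zero_iff {K : A} {X : L.Obj} {κ : L.iota.obj K ⟶ X} (hκ : L.IsUniversal κ) {S : A}
    (l : S ⟶ K) : L.iota.map l ≫ κ = 0 ↔ l = 0 := by
  constructor
  · intro hl
    exact (hκ 0).unique hl (h.map_zero_comp κ)
  · rintro rfl
    exact h.map_zero_comp κ

omit [Homological A] in
theorem forall_eq_zero_iff {K : A} {X : L.Obj} {κ : L.iota.obj K ⟶ X} (hκ : L.IsUniversal κ) :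
    (∀ ⦃S : A⦄ (f : L.iota.obj S ⟶ X), T S → f = 0) ↔ ∀ ⦃S : A⦄ (l : S ⟶ K), T S → l = 0 := by
  constructor
  · intro H S l hS
    exact (h.eq_zero_iff hκ l).1 (H _ hS)
  · intro H S f hS
    obtain ⟨l, rfl, -⟩ := hκ f
    exact (h.eq_zero_iff hκ l).2 (H l hS)

include hTF

/-- The torsion part of X is ιⁿ of the torsion part S of its rib kernel, and the unit `q` is the
extension with this kernel. -/
theorem isExtTorsion (hN : ConditionN T) :
    IsExtTorsion L.ext L.cls (T.map L.iota) L.normalExt where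
  torsion_le := by
    rintro X ⟨S, -, ⟨i⟩⟩
    exact h.isExtensionClass.ext_of_iso i.hom inferInstance (h.ext_iota S)
  torsionFree_le X hX := ((h.normalExt_iff X).1 hX).1
  replete_torsion := inferInstance
  replete_torsionFree := ⟨fun {X Y} i hX => by
    rw [h.normalExt_iff] at hX ⊢
    refine ⟨h.isExtensionClass.ext_of_iso i.hom inferInstance hX.1, fun S f hS => ?_⟩
    rw [← cancel_mono i.inv, hX.2 (f ≫ i.inv) hS, zero_comp]⟩
  hom_eq_zero := by
    rintro X Y ⟨S, hS, ⟨i⟩⟩ hY f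
    rw [← cancel_epi i.hom, ((h.normalExt_iff Y).1 hY).2 (i.hom ≫ f) hS, comp_zero]
  exists_isKernel X hX := by
    have := h.full
    obtain ⟨κ, hκ, hκ'⟩ := h.exists_isUniversal X
    obtain ⟨S, t, ht⟩ := hTF.exists_isCoreflection (L.ribKernel X : A)
    have := hTF.mono_of_isCoreflection ht
    obtain ⟨B, f, hf⟩ := foldr_ribs_isKernel (L.ribs X)
    -- This is where (N) enters, applied to the single morphism whose kernel is the rib kernel.
    obtain ⟨X', q, hq, hu⟩ := h.exists_cls_isKernel (L.iota.map t ≫ κ) hX (by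
      rw [unit_naturality, hκ']
      exact hN f _ t hf ht)
    refine ⟨_, X', _, q, T.prop_map_obj _ ht.mem,
      (h.normalExt_iff X').2 ⟨h.isExtensionClass.cod q hq, ?_⟩, hq, hu⟩
    obtain ⟨κ', hκ', -⟩ := h.exists_isUniversal X'
    obtain ⟨l, hl, -⟩ := hκ' (κ ≫ q)
    -- The map `l` between the rib kernels of X and X' is a normal epimorphism with kernel the
    -- torsion part, so its codomain is torsion-free.
    have hln := h.normalEpi_of_isUniversal κ κ' q l hκ hκ' hq hl
    have hlk : IsKernel t l := by
      refine isKernel_iff.2 ⟨(h.eq_zero_iff hκ' _).1 ?_, inferInstance, fun Z g hg => ?_⟩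
      · rw [L.iota.map_comp, Category.assoc, hl, ← Category.assoc, hu.zero]
      · obtain ⟨m, hm⟩ := hu.lift (L.iota.map g ≫ κ) (by
          rw [Category.assoc, ← hl, ← Category.assoc, ← L.iota.map_comp]
          exact (h.eq_zero_iff hκ' _).2 hg)
        obtain ⟨m, rfl⟩ := L.iota.map_surjective m
        refine ⟨m, (hκ (L.iota.map g ≫ κ)).unique ?_ rfl⟩
        rw [L.iota.map_comp, Category.assoc, hm]
    rw [h.forall_eq_zero_iff hκ', ← hTF.torsionFree_iff]
    exact hTF.torsionFree_of_isCokernel ht (normalEpi_iff.1 hln t hlk)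

omit [Homological A] in
theorem isCoreflection {X : L.Obj} {K S : A} {κ : L.iota.obj K ⟶ X} {t : S ⟶ K}
    (hκ : L.IsUniversal κ) (ht : IsCoreflection T t) :
    IsCoreflection (T.map L.iota) (L.iota.map t ≫ κ) where
  mem := T.prop_map_obj _ ht.mem
  existsUnique := by
    have := h.full
    have := hTF.mono_of_isCoreflection ht
    rintro Z ⟨R, hR, ⟨i⟩⟩ g
    obtain ⟨l, hl, hl'⟩ := hκ (i.hom ≫ g)
    obtain ⟨m, rfl, -⟩ := ht.existsUnique hR l
    refine ⟨i.inv ≫ L.iota.map m, ?_, fun n hn => ?_⟩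
    · dsimp only
      rw [Category.assoc, ← Category.assoc (L.iota.map m), ← L.iota.map_comp, hl, i.inv_hom_id_assoc]
    · obtain ⟨n', hn'⟩ := L.iota.map_surjective (i.hom ≫ n)
      rw [i.eq_inv_comp, ← hn', ← (cancel_mono t).1 (hl' (n' ≫ t) ?_)]
      dsimp only
      rw [L.iota.map_comp, Category.assoc, hn', Category.assoc, hn]

/-- Passing to rib kernels turns the split epimorphism of cubes into one in the base, where (P)
applies; ιⁿ carries the resulting isomorphism back. -/
theorem exists_iso_of_split (hP : ConditionP F) ⦃R X S S' : L.Obj⦄ (p : R ⟶ X) (s : X ⟶ R)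
    (t : S ⟶ R) (t' : S' ⟶ X) (hs : s ≫ p = 𝟙 X) (ht : IsCoreflection (T.map L.iota) t)
    (ht' : IsCoreflection (T.map L.iota) t')
    (H : ∀ ⦃Z : L.Obj⦄ (u : Z ⟶ R), T.map L.iota Z → u ≫ p = 0 → u = 0) :
    ∃ e : S ⟶ S', IsIso e ∧ e ≫ t' = t ≫ p := by
  obtain ⟨κ, hκ, -⟩ := h.exists_isUniversal R
  obtain ⟨κ', hκ', -⟩ := h.exists_isUniversal X
  obtain ⟨S₀, t₀, ht₀⟩ := hTF.exists_isCoreflection (L.ribKernel R : A)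
  obtain ⟨S₀', t₀', ht₀'⟩ := hTF.exists_isCoreflection (L.ribKernel X : A)
  obtain ⟨p₀, hp₀, -⟩ := hκ' (κ ≫ p)
  obtain ⟨s₀, hs₀, -⟩ := hκ (κ' ≫ s)
  obtain ⟨e₀, _, he₀⟩ := hTF.exists_iso_of_split ‹_› hP p₀ s₀ t₀ t₀' ((hκ' κ').unique (by
      rw [L.iota.map_comp, Category.assoc, hp₀, ← Category.assoc, hs₀, Category.assoc, hs,
        Category.comp_id]) (by rw [L.iota.map_id, Category.id_comp])) ht₀ ht₀' (fun Z u hZ hu => by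
    rw [← h.eq_zero_iff hκ]
    refine H _ (T.prop_map_obj _ hZ) ?_
    rw [Category.assoc, ← hp₀, ← Category.assoc, ← L.iota.map_comp]
    exact (h.eq_zero_iff hκ' _).2 hu)
  obtain ⟨a, _, ha⟩ := ht.exists_isIso (h.isCoreflection hTF hκ ht₀)
  obtain ⟨b, _, hb⟩ := (h.isCoreflection hTF hκ' ht₀').exists_isIso ht'
  refine ⟨a ≫ L.iota.map e₀ ≫ b, inferInstance, ?_⟩
  rw [Category.assoc, Category.assoc, hb, ← ha, ← Category.assoc (L.iota.map e₀), ← L.iota.map_comp,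
    he₀, L.iota.map_comp, Category.assoc, Category.assoc, Category.assoc, hp₀]

theorem isAdmissible (hN : ConditionN T) : L.IsAdmissible := by
  have := h.hasFiniteLimits
  exact (h.isExtTorsion hTF hN).isAdmissibleGaloisStructure h.isExtensionClass h.isRelativeClass

theorem isNormal_iff (hP : ConditionP F) (hN : ConditionN T) {a : Arrow L.Obj} (ha : L.cls a.hom) :
    L.IsNormal a ↔ ∀ ⦃S : A⦄ (f : L.iota.obj S ⟶ a.left), T S → f ≫ a.hom = 0 → f = 0 := by
  have := h.hasFiniteLimits
  have hl := h.isExtensionClass.dom _ ha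
  have hr := h.isExtensionClass.cod _ ha
  have key := (h.isExtTorsion hTF hN).isNormalExtension_iff h.isExtensionClass h.isRelativeClass
    (fun R X S S' p s t t' _ _ => h.exists_iso_of_split hTF hP p s t t')
    (ObjectProperty.homMk a.hom :
        (⟨a.left, hl⟩ : L.ext.FullSubcategory) ⟶ ⟨a.right, hr⟩) ha
  rw [forall_map_eq_zero_iff (p := fun _ u => u ≫ a.hom = 0)
    (fun _ _ f u hu => by rw [Category.assoc, hu, comp_zero])]
  exact ⟨fun ⟨_, _, hn⟩ => key.1 hn, fun H => ⟨hl, hr, key.2 H⟩⟩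

end Level.IsRegular

theorem comp_eq_comp_of_mono {C : Type u} [Category.{v} C] {X X' Y Y' Z Z' : C} {f : X ⟶ Y}
    {k : Y ⟶ Z} {g : X ⟶ Z} {f' : X' ⟶ Y'} {k' : Y' ⟶ Z'} {g' : X' ⟶ Z'} {l : X ⟶ X'} {m : Y ⟶ Y'}
    {n : Z ⟶ Z'} [Mono k'] (h : f ≫ k = g) (h' : f' ≫ k' = g') (hm : m ≫ k' = k ≫ n)
    (hl : l ≫ g' = g ≫ n) : l ≫ f' = f ≫ m := by
  rw [← cancel_mono k', Category.assoc, h', hl, Category.assoc, hm, reassoc_of% h]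

/-! ### The functor ι and kernels of double extensions -/

section Iota

variable {C : Type u} [Category.{v} C] [HasZeroMorphisms C]

/-- A kernel is the pullback of f along 0 → Y, and zero objects are extensions. -/
theorem IsExtensionClass.ext_of_isKernel [HasZeroObject C] {ext : ObjectProperty C}
    {E : MorphismProperty C} (h : IsExtensionClass ext E) {K X Y : C} {k : K ⟶ X} {f : X ⟶ Y}
    (hk : IsKernel k f) (hf : E f) : ext K := by
  obtain ⟨Z, hZ⟩ := HasZeroObject.zero (C := C)
  have := hk.mono
  have sq : IsPullback (0 : K ⟶ Z) k (0 : Z ⟶ Y) f := by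
    refine isPullback_of_existsUnique (by rw [zero_comp, hk.zero]) (fun W a b hab => ?_)
      (fun W l l' _ hl => (cancel_mono k).1 hl)
    obtain ⟨l, hl⟩ := hk.lift b (by rw [← hab, comp_zero])
    exact ⟨l, hZ.eq_of_tgt _ _, hl⟩
  exact (h.rel.pullback _ _ _ _ sq (h.ext_zero hZ) (h.dom _ hf) (h.cod _ hf) hf).1

/-- A double extension restricts to an extension between the kernels. -/
theorem IsExtensionClass.mem_of_doubleClass [HasZeroObject C] {ext : ObjectProperty C}
    {E : MorphismProperty C} (h : IsExtensionClass ext E) {a b : Arrow C} {q : a ⟶ b} {K L : C}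
    {k : K ⟶ a.left} {l : L ⟶ b.left} {m : K ⟶ L} (hq : doubleClass E q)
    (hk : IsKernel k a.hom) (hl : IsKernel l b.hom) (hm : m ≫ l = k ≫ q.left) : E m := by
  obtain ⟨-, -, -, hb, P, p₁, p₂, r, sq, hr₁, hr₂, -, -, hr⟩ := hq
  let j : L ⟶ P := sq.lift 0 l (by rw [zero_comp, hl.zero])
  have hj₁ : j ≫ p₁ = 0 := sq.lift_fst _ _ _
  have hj₂ : j ≫ p₂ = l := sq.lift_snd _ _ _
  have hj := hl.of_isPullback sq.flip hj₂ hj₁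
  have := hj.mono
  have := hk.mono
  have hmj : m ≫ j = k ≫ r := by
    apply sq.hom_ext
    · rw [Category.assoc, hj₁, Category.assoc, hr₁, hk.zero, comp_zero]
    · rw [Category.assoc, hj₂, Category.assoc, hr₂, hm]
  -- The kernel of `b.hom` embeds in P by `j`, and `m` is the pullback along it of the comparison
  -- `r`, which is an extension.
  have sq' : IsPullback m k j r := by
    refine isPullback_of_existsUnique hmj (fun W a b hab => ?_)
      (fun W l l' _ hl => (cancel_mono k).1 hl)
    obtain ⟨l, hl⟩ := hk.lift b (by rw [← hr₁, ← Category.assoc, ← hab, Category.assoc, hj₁,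
      comp_zero])
    exact ⟨l, by rw [← cancel_mono j, Category.assoc, hmj, ← Category.assoc, hl, hab], hl⟩
  exact h.fst_mem sq' (h.ext_of_isKernel hl hb) hr

variable [HasZeroObject C]

theorem iotaFunctor_hom_ext {X : C} {a : Arrow C} {f g : (iotaFunctor C).obj X ⟶ a}
    (h : f.left = g.left) : f = g :=
  Arrow.hom_ext _ _ h ((isZero_zero C).eq_of_src _ _)

theorem iotaFunctor_left_comp_hom {X : C} {a : Arrow C} (f : (iotaFunctor C).obj X ⟶ a) :
    f.left ≫ a.hom = 0 :=
  (Arrow.w f).trans zero_comp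

theorem exists_left_eq {X : C} {a : Arrow C} (u : X ⟶ a.left) (hu : u ≫ a.hom = 0) :
    ∃ f : (iotaFunctor C).obj X ⟶ a, f.left = u :=
  ⟨Arrow.homMk (u : ((iotaFunctor C).obj X).left ⟶ a.left) 0 (hu.trans comp_zero.symm), rfl⟩

instance : (iotaFunctor C).Full where
  map_surjective f := ⟨f.left, iotaFunctor_hom_ext rfl⟩

instance : (iotaFunctor C).Faithful where
  map_injective h := congrArg (·.left) h

end Iota

/-! ### Base case and inductive step -/

namespace Level

variable {A : Type u} [Category.{v} A] {L : Level.{w} A}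

/-- Morphisms ιⁿ⁺¹S → a are morphisms from ιⁿS to the kernel of a, so both levels have the same
representing object K. -/
theorem isUniversal_of_next {K : A} {a : Arrow L.Obj} {κ : L.next.iota.obj K ⟶ a}
    (hκ : L.next.IsUniversal κ) {K' : L.Obj} {k : K' ⟶ a.left} (hk : IsKernel k a.hom)
    {κ' : L.iota.obj K ⟶ K'} (hκ' : κ' ≫ k = κ.left) : L.IsUniversal κ' := by
  intro S g
  have := hk.mono
  obtain ⟨f, hf⟩ := exists_left_eq (a := a) (g ≫ k) (by rw [Category.assoc, hk.zero, comp_zero])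
  have key : ∀ l : S ⟶ K, L.next.iota.map l ≫ κ = f ↔ L.iota.map l ≫ κ' = g := fun l => by
    rw [← cancel_mono k, ← hf, Category.assoc, hκ']
    exact ⟨fun h => congrArg (·.left) h, fun h => iotaFunctor_hom_ext h⟩
  simpa only [key] using hκ f

theorem next_forall_eq_zero_iff {T : ObjectProperty A} {a : L.next.Obj} :
    (∀ ⦃S : A⦄ (f : L.next.iota.obj S ⟶ a), T S → f = 0) ↔
      ∀ ⦃S : A⦄ (u : L.iota.obj S ⟶ Arrow.left a), T S → u ≫ Arrow.hom a = 0 → u = 0 := by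
  constructor
  · intro H S u hS hu
    obtain ⟨f, rfl⟩ := exists_left_eq u hu
    exact congrArg (·.left) (H f hS)
  · intro H S f hS
    exact iotaFunctor_hom_ext (H f.left hS (iotaFunctor_left_comp_hom f))

/-- The natural transformation `X ⟶ top (ιⁿ⁺¹ X)`. -/
def nextUnit (e : 𝟭 A ⟶ L.iota ⋙ L.top) : 𝟭 A ⟶ L.next.iota ⋙ L.next.top where
  app S := e.app S
  naturality _ _ f := e.naturality f

variable [HasZeroMorphisms A]

theorem normalEpi_of_isIso_square [Homological A] {X Y X' Y' : A} {κ : X ⟶ X'} {κ' : Y ⟶ Y'}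
    {q : X' ⟶ Y'} {l : X ⟶ Y} [IsIso κ] [IsIso κ'] (hq : Nonempty (NormalEpi q))
    (h : l ≫ κ' = κ ≫ q) : Nonempty (NormalEpi l) := by
  rw [← (IsIso.comp_inv_eq κ').2 h.symm, Category.assoc]
  exact normalEpi_comp (normalEpi_of_isIso κ) (normalEpi_comp hq (normalEpi_of_isIso _))

/-- The decisive field is `normalExt_iff`: the criterion for normality at level n, read through
`next_forall_eq_zero_iff`, is torsion-freeness at level n + 1. Conditions (P) and (N) are used only
there. -/
theorem IsRegular.next [Homological A] {T F : ObjectProperty A} {e : 𝟭 A ⟶ L.iota ⋙ L.top}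
    (h : L.IsRegular T F e) (hTF : IsTorsionTheory T F) (hP : ConditionP F) (hN : ConditionN T) :
    L.next.IsRegular T F (nextUnit e) where
  hasFiniteLimits := by
    have := h.hasFiniteLimits
    exact inferInstanceAs (HasFiniteLimits (Arrow L.Obj))
  isExtensionClass := by
    have := h.hasFiniteLimits
    exact h.isExtensionClass.arrow
  isRelativeClass := by
    have := h.hasFiniteLimits
    exact h.isExtensionClass.arrow.rel
  full := by
    have := h.full
    exact inferInstanceAs (L.iota ⋙ iotaFunctor L.Obj).Full
  faithful := by
    have := h.faithful
    exact inferInstanceAs (L.iota ⋙ iotaFunctor L.Obj).Faithful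
  top_zero X Y := h.top_zero _ _
  ext_iota S := h.isExtensionClass.to_zero _ (h.ext_iota S) (isZero_zero _)
  hom_ext S X f g hfg := iotaFunctor_hom_ext (h.hom_ext _ _ hfg)
  exists_iff S X v := by
    refine Iff.trans ?_ List.forall_mem_cons.symm
    have key : ∀ u : L.iota.obj S ⟶ X.left, (e.app S ≫ L.top.map u) ≫ L.top.map X.hom = 0 ↔
        u ≫ X.hom = 0 := fun u => by
      rw [Category.assoc, ← L.top.map_comp]
      refine ⟨fun hu => h.hom_ext _ _ ?_, fun hu => ?_⟩
      · rw [hu, h.top_zero, comp_zero]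
      · rw [hu, h.top_zero, comp_zero]
    constructor
    · rintro ⟨f, rfl⟩
      exact ⟨(key f.left).2 (iotaFunctor_left_comp_hom f), (h.exists_iff _).1 ⟨f.left, rfl⟩⟩
    · rintro ⟨h₁, h₂⟩
      obtain ⟨u, rfl⟩ := (h.exists_iff v).2 h₂
      obtain ⟨f, rfl⟩ := exists_left_eq u ((key u).1 h₁)
      exact ⟨f, rfl⟩
  torsionFree_iff a := by
    rw [next_forall_eq_zero_iff]
    constructor
    · rintro ⟨K, k, hk, hK⟩ S u hS hu
      obtain ⟨l, rfl⟩ := hk.lift u hu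
      rw [(h.torsionFree_iff K).1 hK l hS, zero_comp]
    · intro H
      have := h.hasFiniteLimits
      obtain ⟨K, k, hk⟩ := HigherTorsion.exists_isKernel a.hom
      have := hk.mono
      refine ⟨K, k, hk, (h.torsionFree_iff K).2 fun S u hS => ?_⟩
      rw [← cancel_mono k, zero_comp]
      exact H _ hS (by rw [Category.assoc, hk.zero, comp_zero])
  normalExt_iff a := by
    rw [next_forall_eq_zero_iff]
    exact and_congr_right fun ha => h.isNormal_iff hTF hP hN ha
  exists_cls_isKernel S a f ha hf := by
    have := h.hasFiniteLimits
    have hE := h.isExtensionClass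
    obtain ⟨X', q, hq, hk⟩ := h.exists_cls_isKernel f.left (hE.dom _ ha) hf
    obtain ⟨f', hf'⟩ := (hE.isCokernel _ _ hq hk).desc a.hom (iotaFunctor_left_comp_hom f)
    have ha' : L.cls f' := hE.of_comp hq (hf' ▸ ha)
    -- Only the domain of a is divided; the codomain keeps its identity. The comparison to the
    -- pullback is then `q` itself, and the kernel has zero codomain, as an object in the image of ι
    -- must.
    let q' : a ⟶ Arrow.mk f' := Arrow.homMk q (𝟙 _) (hf'.trans (Category.comp_id _).symm)
    refine ⟨Arrow.mk f', q', ?_, arrow_isKernel hk ?_⟩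
    · have hE₁ : L.cls (𝟙 (Arrow.right a)) := hE.mem_of_isIso _ (hE.cod _ ha)
      exact hE.doubleClass_of (f := q') hq hE₁ ha ha' (P := X')
        (p₁ := f') (p₂ := 𝟙 _) (r := q) (IsPullback.id_horiz f').flip hf' (Category.comp_id _) hq
    · have hz : IsZero ((L.next.iota.obj S).right) := isZero_zero L.Obj
      refine isKernel_iff.2 ⟨hz.eq_of_src _ _, ⟨fun _ _ _ => hz.eq_of_tgt _ _⟩, fun Z g hg => ⟨0, ?_⟩⟩
      rw [zero_comp]
      exact hg.symm.trans (Category.comp_id _)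
  normalEpi_of_isUniversal K K' a a' κ κ' q l hκ hκ' hq hl := by
    have := h.hasFiniteLimits
    have hE := h.isExtensionClass
    obtain ⟨B, k, hk⟩ := HigherTorsion.exists_isKernel a.hom
    obtain ⟨B', k', hk'⟩ := HigherTorsion.exists_isKernel a'.hom
    have := hk'.mono
    obtain ⟨m, hm⟩ := hk'.lift (k ≫ q.left) (by
      rw [Category.assoc, Arrow.w q, ← Category.assoc, hk.zero, zero_comp])
    obtain ⟨κ₀, hκ₀⟩ := hk.lift κ.left (iotaFunctor_left_comp_hom κ)
    obtain ⟨κ₀', hκ₀'⟩ := hk'.lift κ'.left (iotaFunctor_left_comp_hom κ')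
    -- A double extension restricts to an extension `m` between kernels, whose universal objects are
    -- still K and K'.
    refine h.normalEpi_of_isUniversal κ₀ κ₀' m l (isUniversal_of_next hκ hk hκ₀)
      (isUniversal_of_next hκ' hk' hκ₀') (hE.mem_of_doubleClass hq hk hk' hm)
      (comp_eq_comp_of_mono hκ₀ hκ₀' hm (congrArg (·.left) hl))

/-- The identity, as a natural transformation `X ⟶ top (ι⁰ X)`. -/
def baseUnit [HasZeroObject A] (F : ObjectProperty A) :
    𝟭 A ⟶ (base F).iota ⋙ (base F).top :=
  𝟙 (𝟭 A)

theorem isRegular_base [Homological A] {T F : ObjectProperty A} (hTF : IsTorsionTheory T F)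
    (hdesc : ∀ ⦃X Y : A⦄ (f : X ⟶ Y), Nonempty (NormalEpi f) → IsEffectiveDescent f) :
    (base F).IsRegular T F (baseUnit F) where
  hasFiniteLimits := inferInstanceAs (HasFiniteLimits A)
  isExtensionClass := by
    have := isExtensionClass_normalEpis hdesc
    exact this
  isRelativeClass := isRelativeClass_top (A := A)
  full := inferInstanceAs (𝟭 A).Full
  faithful := inferInstanceAs (𝟭 A).Faithful
  top_zero _ _ := rfl
  ext_iota _ := trivial
  hom_ext S X f g hfg := (Category.id_comp f).symm.trans (hfg.trans (Category.id_comp g))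
  exists_iff S X v := ⟨fun _ _ ha => absurd ha List.not_mem_nil, fun _ => ⟨v, Category.id_comp v⟩⟩
  torsionFree_iff X := hTF.torsionFree_iff
  normalExt_iff X := hTF.torsionFree_iff.trans (true_and _).to_iff.symm
  exists_cls_isKernel := by
    have key : ∀ ⦃S X : A⦄ (f : S ⟶ X), True → Nonempty (NormalMono (𝟙 S ≫ f)) →
        ∃ (X' : A) (q : X ⟶ X'), Nonempty (NormalEpi q) ∧ IsKernel f q := fun S X f _ hf => by
      rw [Category.id_comp] at hf
      exact exists_normalEpi_of_normalMono f hf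
    exact key
  normalEpi_of_isUniversal := by
    -- At level zero ι is the identity, so a universal morphism is an isomorphism and `l` is `q` up
    -- to isomorphism.
    have key : ∀ ⦃K X : A⦄ (κ : K ⟶ X),
        (∀ ⦃S : A⦄ (g : S ⟶ X), ∃! l : S ⟶ K, l ≫ κ = g) → IsIso κ := fun K X κ hκ => by
      obtain ⟨s, hs, -⟩ := hκ (𝟙 X)
      exact ⟨s, (hκ κ).unique (by rw [Category.assoc, hs, Category.comp_id]) (Category.id_comp κ), hs⟩
    have key' : ∀ ⦃K K' X X' : A⦄ (κ : K ⟶ X) (κ' : K' ⟶ X') (q : X ⟶ X') (l : K ⟶ K'),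
        (∀ ⦃S : A⦄ (g : S ⟶ X), ∃! l : S ⟶ K, l ≫ κ = g) →
        (∀ ⦃S : A⦄ (g : S ⟶ X'), ∃! l : S ⟶ K', l ≫ κ' = g) →
        Nonempty (NormalEpi q) → l ≫ κ' = κ ≫ q → Nonempty (NormalEpi l) :=
      fun K K' X X' κ κ' q l hκ hκ' hq hl => by
        have := key κ hκ
        have := key κ' hκ'
        exact normalEpi_of_isIso_square hq hl
    exact key'

end Level

/-! ### The tower and the conclusion -/

namespace Level

variable {A : Type u} [Category.{v} A] [HasZeroMorphisms A] [Homological A]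
  {T F : ObjectProperty A}

theorem IsRegular.normalExt_iff_ribKernel {L : Level.{w} A} {e : 𝟭 A ⟶ L.iota ⋙ L.top}
    (h : L.IsRegular T F e) (hTF : IsTorsionTheory T F) {X : L.Obj} (hX : L.ext X) :
    L.normalExt X ↔ F (L.ribKernel X : A) := by
  obtain ⟨κ, hκ, -⟩ := h.exists_isUniversal X
  rw [h.normalExt_iff, and_iff_right hX, h.forall_eq_zero_iff hκ, hTF.torsionFree_iff]

theorem exists_isRegular_tower
    (hdesc : ∀ ⦃X Y : A⦄ (f : X ⟶ Y), Nonempty (NormalEpi f) → IsEffectiveDescent f)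
    (hTF : IsTorsionTheory T F) (hP : ConditionP F) (hN : ConditionN T) (k : ℕ) :
    ∃ e, (tower F k).IsRegular T F e := by
  induction k with
  | zero => exact ⟨_, (isRegular_base hTF hdesc).next hTF hP hN⟩
  | succ k ih =>
    obtain ⟨e, he⟩ := ih
    exact ⟨_, he.next hTF hP hN⟩

end Level

end HigherTorsion

open HigherTorsion in
theorem theorem4 {A : Type u} [Category.{v} A] [HasZeroMorphisms A] [Homological A]
    (hdesc : ∀ ⦃X Y : A⦄ (f : X ⟶ Y), Nonempty (NormalEpi f) → IsEffectiveDescent f)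
    (T F : ObjectProperty A) (hTF : IsTorsionTheory T F)
    (hP : ConditionP F) (hN : ConditionN T) :
    (Level.base F).IsAdmissible ∧
    ∀ k : ℕ,
      -- the level `n = k + 1`
      (Level.tower F k).IsAdmissible ∧
      T.map (Level.tower F k).iota ≤ (Level.tower F k).ext ∧
      IsTorsionTheory
        ((T.map (Level.tower F k).iota).inverseImage (Level.tower F k).ext.ι)
        ((Level.tower F k).normalExt.inverseImage (Level.tower F k).ext.ι) ∧
      (Level.tower F k).normalExt = (Level.tower F k).torsionFree ⊓ (Level.tower F k).ext ∧
      ∀ X : (Level.tower F k).Obj, (Level.tower F k).ext X →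
        ((Level.tower F k).normalExt X ↔ F ((Level.tower F k).ribKernel X : A)) := by
  refine ⟨(Level.isRegular_base hTF hdesc).isAdmissible hTF hN, fun k => ?_⟩
  obtain ⟨e, h⟩ := Level.exists_isRegular_tower hdesc hTF hP hN k
  have hT := h.isExtTorsion hTF hN
  refine ⟨h.isAdmissible hTF hN, hT.torsion_le, hT.isTorsionTheory h.isExtensionClass, ?_,
    fun X hX => h.normalExt_iff_ribKernel hTF hX⟩
  ext X
  -- Normal extensions and ℱₙ are characterised by the same vanishing condition; only membership in
  -- `ext` differs.
  exact (h.normalExt_iff X).trans (and_comm.trans (and_congr_left' (h.torsionFree_iff X).symm))
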